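/- Let $n\ge 1$ and $m\ge 0$ be integers, $N=n+m$, and write the points of $\mathbb R^N=\mathbb R^n\times\mathbb R^m$ as $z=(x,y)$. Let $\Omega\subset\mathbb R^N$ be a bounded domain with smooth boundary such that $\Omega\cap\{x=0\}\neq\emptyset$. Let $G$ be continuous on $\overline\Omega$ and of class $C^1$ on $\Omega$, with $G(z)\in(2,N)$ for all $z\in\Omega$, and put $G^-=\inf_\Omega G$. Let $1<s<G^-$ and $0<\gamma<\dfrac{N(G^--s)}{s}$. For a measurable exponent $p\ge 1$ on $\Omega$ let $$|f|_{p(z)}=\inf\Big\{\lambda>0:\ \int_\Omega |f(z)/\lambda|^{p(z)}\,dz\le 1\Big\}$$ be the Luxemburg norm, let $A(z)=|\mathrm{grad}_xG(z)|+|x|^\gamma|\mathrm{grad}_yG(z)|$, and let $\mathcal W$ be the closure (completion) of $C^1_c(\Omega)$ with respect to the norm $$\|u\|=\big|\mathrm{grad}_xu\big|_{G(z)}+\Big||x|^{\gamma/G(z)}\,\mathrm{grad}_yu\Big|_{G(z)}+\Big|u\,A^{1/(G(z)+1)}\Big|_{G(z)+1}+\Big|u\,A^{1/(G(z)-1)}\Big|_{G(z)-1}.$$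 Then $\mathcal W$ is compactly embedded in $L^s(\Omega)$: the inclusion $C^1_c(\Omega)\to L^s(\Omega)$ extends to an injective compact linear operator $\mathcal W\to L^s(\Omega)$. -/

import Mathlib

open MeasureTheory Set Filter Topology
open scoped ENNReal ContDiff

noncomputable section

/-- The modular `∫ |f(z)| ^ p(z) dμ(z)` of the variable-exponent Lebesgue space `L^{p(·)}(μ)`. -/
def varModular {α : Type*} [MeasurableSpace α] (μ : Measure α) (p f : α → ℝ) : ℝ≥0∞ :=
  ∫⁻ z, ENNReal.ofReal (|f z| ^ p z) ∂μ

/-- The Luxemburg norm `|f|_{p(z)} = inf {l > 0 : ∫ |f(z) / l| ^ p(z) dμ(z) ≤ 1}`. -/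
def luxNorm {α : Type*} [MeasurableSpace α] (μ : Measure α) (p f : α → ℝ) : ℝ :=
  sInf {l : ℝ | 0 < l ∧ varModular μ p (fun z => f z / l) ≤ 1}

section Lux

variable {α : Type*} [MeasurableSpace α] {μ : Measure α} {p f g h : α → ℝ}

theorem luxNorm_nonneg : 0 ≤ luxNorm μ p f :=
  Real.sInf_nonneg fun _ hl => hl.1.le

theorem luxNorm_zero (hp : ∀ᵐ z ∂μ, 1 ≤ p z) (hf : ∀ z, f z = 0) : luxNorm μ p f = 0 := by
  have hmod : ∀ l : ℝ, varModular μ p (fun z => f z / l) = 0 := by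
    intro l
    unfold varModular
    rw [lintegral_congr_ae (g := fun _ => 0)]
    · simp
    · filter_upwards [hp] with z hz
      simp [hf z, Real.zero_rpow (by linarith : p z ≠ 0)]
  have : {l : ℝ | 0 < l ∧ varModular μ p (fun z => f z / l) ≤ 1} = Ioi 0 := by
    ext l; simp [hmod l]
  rw [luxNorm, this, csInf_Ioi]

theorem luxNorm_le_add (hp : ∀ᵐ z ∂μ, 1 ≤ p z) (hpm : AEMeasurable p μ)
    (hgm : AEMeasurable g μ)
    (hg : ∃ l : ℝ, 0 < l ∧ varModular μ p (fun z => g z / l) ≤ 1)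
    (hh : ∃ l : ℝ, 0 < l ∧ varModular μ p (fun z => h z / l) ≤ 1)
    (hfgh : ∀ z, |f z| ≤ |g z| + |h z|) :
    luxNorm μ p f ≤ luxNorm μ p g + luxNorm μ p h := by
  have key : ∀ a : ℝ, (0 < a ∧ varModular μ p (fun z => g z / a) ≤ 1) →
      ∀ b : ℝ, (0 < b ∧ varModular μ p (fun z => h z / b) ≤ 1) →
      luxNorm μ p f ≤ a + b := by
    rintro a ⟨ha, hga⟩ b ⟨hb, hhb⟩
    have hab : 0 < a + b := by positivity
    refine csInf_le ⟨0, fun _ hl => hl.1.le⟩ ⟨hab, ?_⟩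
    have hpt : ∀ᵐ z ∂μ, ENNReal.ofReal (|f z / (a + b)| ^ p z) ≤
        ENNReal.ofReal (a / (a + b)) * ENNReal.ofReal (|g z / a| ^ p z) +
        ENNReal.ofReal (b / (a + b)) * ENNReal.ofReal (|h z / b| ^ p z) := by
      filter_upwards [hp] with z hz
      rw [← ENNReal.ofReal_mul (by positivity), ← ENNReal.ofReal_mul (by positivity),
        ← ENNReal.ofReal_add (by positivity) (by positivity)]
      refine ENNReal.ofReal_le_ofReal ?_
      have h1 : |f z / (a + b)| ≤ a / (a + b) * |g z / a| + b / (a + b) * |h z / b| := by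
        rw [abs_div, abs_div, abs_div, abs_of_pos hab, abs_of_pos ha, abs_of_pos hb]
        have : a / (a + b) * (|g z| / a) + b / (a + b) * (|h z| / b)
            = (|g z| + |h z|) / (a + b) := by field_simp
        rw [this]
        gcongr
        exact hfgh z
      have h2 := (convexOn_rpow hz).2 (mem_Ici.2 (abs_nonneg (g z / a)))
        (mem_Ici.2 (abs_nonneg (h z / b))) (show 0 ≤ a / (a + b) by positivity)
        (show 0 ≤ b / (a + b) by positivity) (by field_simp)
      simp only [smul_eq_mul] at h2
      exact (Real.rpow_le_rpow (abs_nonneg _) h1 (by linarith)).trans h2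
    have hm : AEMeasurable (fun z => ENNReal.ofReal (a / (a + b)) *
        ENNReal.ofReal (|g z / a| ^ p z)) μ := by
      have : AEMeasurable (fun z => |g z / a|) μ := by
        simpa only [Real.norm_eq_abs] using (hgm.div_const a).norm
      exact ((this.pow hpm).ennreal_ofReal).const_mul _
    calc varModular μ p (fun z => f z / (a + b))
        ≤ ∫⁻ z, (ENNReal.ofReal (a / (a + b)) * ENNReal.ofReal (|g z / a| ^ p z) +
          ENNReal.ofReal (b / (a + b)) * ENNReal.ofReal (|h z / b| ^ p z)) ∂μ :=
          lintegral_mono_ae hpt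
      _ = ENNReal.ofReal (a / (a + b)) * varModular μ p (fun z => g z / a) +
          ENNReal.ofReal (b / (a + b)) * varModular μ p (fun z => h z / b) := by
          rw [lintegral_add_left' hm, lintegral_const_mul' _ _ ENNReal.ofReal_ne_top,
            lintegral_const_mul' _ _ ENNReal.ofReal_ne_top]
          rfl
      _ ≤ ENNReal.ofReal (a / (a + b)) * 1 + ENNReal.ofReal (b / (a + b)) * 1 := by gcongr
      _ = 1 := by
          rw [mul_one, mul_one, ← ENNReal.ofReal_add (by positivity) (by positivity),
            ← add_div, div_self hab.ne', ENNReal.ofReal_one]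
  have h1 : ∀ b : ℝ, (0 < b ∧ varModular μ p (fun z => h z / b) ≤ 1) →
      luxNorm μ p f - b ≤ luxNorm μ p g := by
    intro b hb
    refine le_csInf hg fun a ha => ?_
    linarith [key a ha b hb]
  have h2 : luxNorm μ p f - luxNorm μ p g ≤ luxNorm μ p h :=
    le_csInf hh fun b hb => by linarith [h1 b hb]
  linarith

theorem luxNorm_le_mul {c : ℝ} (hp : ∀ᵐ z ∂μ, 1 ≤ p z)
    (hg : ∃ l : ℝ, 0 < l ∧ varModular μ p (fun z => g z / l) ≤ 1)
    (hfg : ∀ z, |f z| = |c| * |g z|) :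
    luxNorm μ p f ≤ |c| * luxNorm μ p g := by
  rcases eq_or_ne c 0 with rfl | hc
  · rw [luxNorm_zero hp (fun z => by simpa using hfg z)]
    simp
  · have hc' : 0 < |c| := abs_pos.2 hc
    rw [mul_comm, ← div_le_iff₀ hc']
    refine le_csInf hg fun a ha => ?_
    rw [div_le_iff₀ hc']
    refine csInf_le ⟨0, fun _ hl => hl.1.le⟩ ⟨mul_pos ha.1 hc', ?_⟩
    have : varModular μ p (fun z => f z / (a * |c|)) = varModular μ p (fun z => g z / a) := by
      unfold varModular
      refine lintegral_congr fun z => ?_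
      have : |f z / (a * |c|)| = |g z / a| := by
        rw [abs_div, abs_div, abs_mul, abs_abs, hfg z]
        have := abs_pos.2 ha.1.ne'
        field_simp
      rw [this]
    rw [this]
    exact ha.2

end Lux

/-- `ℝ^N = ℝⁿ × ℝᵐ`, with points `z = (x, y)`; its `volume` is Lebesgue measure. -/
abbrev GrushinPt (n m : ℕ) : Type := EuclideanSpace ℝ (Fin n) × EuclideanSpace ℝ (Fin m)

/-- The partial gradient `grad_x u`. -/
def gradX {n m : ℕ} (u : GrushinPt n m → ℝ) (z : GrushinPt n m) : EuclideanSpace ℝ (Fin n) :=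
  gradient (fun x => u (x, z.2)) z.1

/-- The partial gradient `grad_y u`. -/
def gradY {n m : ℕ} (u : GrushinPt n m → ℝ) (z : GrushinPt n m) : EuclideanSpace ℝ (Fin m) :=
  gradient (fun y => u (z.1, y)) z.2

/-- Smooth boundary: near each boundary point, `Ω` is the negativity set of a smooth function
whose differential does not vanish at that point. -/
def HasSmoothBoundary {n m : ℕ} (Ω : Set (GrushinPt n m)) : Prop :=
  ∀ z ∈ frontier Ω, ∃ (U : Set (GrushinPt n m)) (ρ : GrushinPt n m → ℝ),
    IsOpen U ∧ z ∈ U ∧ ContDiffOn ℝ ∞ ρ U ∧ fderiv ℝ ρ z ≠ 0 ∧ Ω ∩ U = {w ∈ U | ρ w < 0}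

/-- The standing setting: a bounded smooth domain `Ω ⊆ ℝⁿ × ℝᵐ` meeting `{x = 0}`, a `C¹`
variable exponent `G` with values in `(2, N)`, `N = n + m`, and a weight exponent `γ > 0`. -/
structure GrushinSetting (n m : ℕ) where
  Ω : Set (GrushinPt n m)
  isOpen : IsOpen Ω
  isConnected : IsConnected Ω
  isBounded : Bornology.IsBounded Ω
  smoothBoundary : HasSmoothBoundary Ω
  meets : ∃ z ∈ Ω, z.1 = 0
  G : GrushinPt n m → ℝ
  continuousOn_G : ContinuousOn G (closure Ω)
  contDiffOn_G : ContDiffOn ℝ 1 G Ω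
  two_lt_G : ∀ z ∈ Ω, 2 < G z
  G_lt : ∀ z ∈ Ω, G z < (n : ℝ) + m
  γ : ℝ
  γ_pos : 0 < γ

section Grad

variable {n m : ℕ} {u v : GrushinPt n m → ℝ} {z : GrushinPt n m}

theorem gradX_eq (h : DifferentiableAt ℝ u z) :
    gradX u z = (InnerProductSpace.toDual ℝ _).symm
      ((fderiv ℝ u z).comp (ContinuousLinearMap.inl ℝ _ _)) := by
  unfold gradX gradient
  congr 1
  have h1 : HasFDerivAt (fun x => ((x, z.2) : GrushinPt n m))
      (ContinuousLinearMap.inl ℝ _ _) z.1 := hasFDerivAt_prodMk_left z.1 z.2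
  exact (HasFDerivAt.comp (g := u) z.1 h.hasFDerivAt h1).fderiv

theorem gradY_eq (h : DifferentiableAt ℝ u z) :
    gradY u z = (InnerProductSpace.toDual ℝ _).symm
      ((fderiv ℝ u z).comp (ContinuousLinearMap.inr ℝ _ _)) := by
  unfold gradY gradient
  congr 1
  have h1 : HasFDerivAt (fun y => ((z.1, y) : GrushinPt n m))
      (ContinuousLinearMap.inr ℝ _ _) z.2 := hasFDerivAt_prodMk_right z.1 z.2
  exact (HasFDerivAt.comp (g := u) z.2 h.hasFDerivAt h1).fderiv

theorem continuousOn_gradX {Ω : Set (GrushinPt n m)} (hΩ : IsOpen Ω) (h : ContDiffOn ℝ 1 u Ω) :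
    ContinuousOn (gradX u) Ω := by
  have h1 := h.continuousOn_fderiv_of_isOpen hΩ le_rfl
  refine ContinuousOn.congr (f := fun z => (InnerProductSpace.toDual ℝ _).symm
      ((fderiv ℝ u z).comp (ContinuousLinearMap.inl ℝ _ _))) ?_ fun z hz =>
    gradX_eq ((h.differentiableOn one_ne_zero).differentiableAt (hΩ.mem_nhds hz))
  exact (LinearIsometryEquiv.continuous _).comp_continuousOn (h1.clm_comp continuousOn_const)

theorem continuousOn_gradY {Ω : Set (GrushinPt n m)} (hΩ : IsOpen Ω) (h : ContDiffOn ℝ 1 u Ω) :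
    ContinuousOn (gradY u) Ω := by
  have h1 := h.continuousOn_fderiv_of_isOpen hΩ le_rfl
  refine ContinuousOn.congr (f := fun z => (InnerProductSpace.toDual ℝ _).symm
      ((fderiv ℝ u z).comp (ContinuousLinearMap.inr ℝ _ _))) ?_ fun z hz =>
    gradY_eq ((h.differentiableOn one_ne_zero).differentiableAt (hΩ.mem_nhds hz))
  exact (LinearIsometryEquiv.continuous _).comp_continuousOn (h1.clm_comp continuousOn_const)

theorem gradX_of_notMem_tsupport (hu : Differentiable ℝ u) (h : z ∉ tsupport u) :
    gradX u z = 0 := by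
  rw [gradX_eq (hu z), fderiv_of_notMem_tsupport ℝ h]
  simp

theorem gradY_of_notMem_tsupport (hu : Differentiable ℝ u) (h : z ∉ tsupport u) :
    gradY u z = 0 := by
  rw [gradY_eq (hu z), fderiv_of_notMem_tsupport ℝ h]
  simp

theorem gradX_add (hu : Differentiable ℝ u) (hv : Differentiable ℝ v) :
    gradX (u + v) z = gradX u z + gradX v z := by
  rw [gradX_eq ((hu z).add (hv z)), gradX_eq (hu z), gradX_eq (hv z), fderiv_add (hu z) (hv z),
    ContinuousLinearMap.add_comp, map_add]

theorem gradY_add (hu : Differentiable ℝ u) (hv : Differentiable ℝ v) :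
    gradY (u + v) z = gradY u z + gradY v z := by
  rw [gradY_eq ((hu z).add (hv z)), gradY_eq (hu z), gradY_eq (hv z), fderiv_add (hu z) (hv z),
    ContinuousLinearMap.add_comp, map_add]

theorem gradX_smul (c : ℝ) (hu : Differentiable ℝ u) : gradX (c • u) z = c • gradX u z := by
  rw [gradX_eq ((hu z).const_smul c), gradX_eq (hu z), fderiv_const_smul (hu z),
    ContinuousLinearMap.smul_comp]
  simp

theorem gradY_smul (c : ℝ) (hu : Differentiable ℝ u) : gradY (c • u) z = c • gradY u z := by
  rw [gradY_eq ((hu z).const_smul c), gradY_eq (hu z), fderiv_const_smul (hu z),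
    ContinuousLinearMap.smul_comp]
  simp

end Grad

namespace GrushinSetting

variable {n m : ℕ} (D : GrushinSetting n m)

/-- `G⁻ = inf {G(z) : z ∈ Ω}`. -/
def Gminus : ℝ := sInf (D.G '' D.Ω)

/-- `A(z) = |grad_x G(z)| + |x|^γ |grad_y G(z)|`. -/
def A (z : GrushinPt n m) : ℝ := ‖gradX D.G z‖ + ‖z.1‖ ^ D.γ * ‖gradY D.G z‖

/-- Lebesgue measure on `Ω`. -/
abbrev μ : Measure (GrushinPt n m) := volume.restrict D.Ω

/-- `C¹_c(Ω)`, as a space of functions extended by zero to `ℝⁿ × ℝᵐ`. -/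
def c1cSubmodule : Submodule ℝ (GrushinPt n m → ℝ) where
  carrier := {u | ContDiff ℝ 1 u ∧ HasCompactSupport u ∧ tsupport u ⊆ D.Ω}
  zero_mem' := ⟨contDiff_const, HasCompactSupport.zero, by simp⟩
  add_mem' := by
    rintro u v ⟨h1, h2, h3⟩ ⟨k1, k2, k3⟩
    exact ⟨h1.add k1, h2.add k2, (tsupport_add u v).trans (union_subset h3 k3)⟩
  smul_mem' := by
    rintro c u ⟨h1, h2, h3⟩
    exact ⟨contDiff_const.smul h1, h2.smul_left (f := fun _ => c),
      (tsupport_smul_subset_right (fun _ => c) u).trans h3⟩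

/-- `C¹_c(Ω)` as a type of its own, to be equipped with the norm of `W`. -/
def C1c : Type := ↥D.c1cSubmodule

instance : AddCommGroup D.C1c := inferInstanceAs (AddCommGroup ↥D.c1cSubmodule)
instance : Module ℝ D.C1c := inferInstanceAs (Module ℝ ↥D.c1cSubmodule)

variable {D}

/-- The function underlying an element of `C¹_c(Ω)`. -/
def C1c.toFun (u : D.C1c) : GrushinPt n m → ℝ := u.1

instance : CoeFun D.C1c (fun _ => GrushinPt n m → ℝ) := ⟨C1c.toFun⟩

/-- The norm of `W`:
`|grad_x u|_{G} + | |x|^{γ/G} grad_y u |_{G} + |u A^{1/(G+1)}|_{G+1} + |u A^{1/(G-1)}|_{G-1}`. -/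
def C1c.wNorm (u : D.C1c) : ℝ :=
  luxNorm D.μ D.G (fun z => ‖gradX u z‖) +
  luxNorm D.μ D.G (fun z => ‖z.1‖ ^ (D.γ / D.G z) * ‖gradY u z‖) +
  luxNorm D.μ (fun z => D.G z + 1) (fun z => u z * D.A z ^ (1 / (D.G z + 1))) +
  luxNorm D.μ (fun z => D.G z - 1) (fun z => u z * D.A z ^ (1 / (D.G z - 1)))

theorem C1c.contDiff (u : D.C1c) : ContDiff ℝ 1 u := u.2.1

theorem C1c.differentiable (u : D.C1c) : Differentiable ℝ u :=
  u.contDiff.differentiable one_ne_zero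

theorem C1c.isCompact (u : D.C1c) : IsCompact (tsupport u) := u.2.2.1

theorem C1c.subset (u : D.C1c) : tsupport u ⊆ D.Ω := u.2.2.2

theorem C1c.coe_add (u v : D.C1c) : ((u + v : D.C1c) : GrushinPt n m → ℝ) = u.toFun + v.toFun :=
  rfl

theorem C1c.coe_smul (c : ℝ) (u : D.C1c) : ((c • u : D.C1c) : GrushinPt n m → ℝ) = c • u.toFun :=
  rfl

theorem exists_modular_le {p f : GrushinPt n m → ℝ} {K : Set (GrushinPt n m)}
    (hp : ∀ z ∈ D.Ω, 1 ≤ p z) (hK : IsCompact K) (hKΩ : K ⊆ D.Ω) (hf : ContinuousOn f D.Ω)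
    (hf0 : ∀ z ∉ K, f z = 0) :
    ∃ l : ℝ, 0 < l ∧ varModular D.μ p (fun z => f z / l) ≤ 1 := by
  obtain ⟨M, hM⟩ := hK.exists_bound_of_continuousOn (hf.mono hKΩ)
  set V : ℝ := (volume K).toReal with hV
  have hV0 : 0 ≤ V := ENNReal.toReal_nonneg
  set M' : ℝ := max M 1
  have hM' : 1 ≤ M' := le_max_right _ _
  set l : ℝ := M' * (V + 1) with hl
  have hlpos : 0 < l := by positivity
  refine ⟨l, hlpos, ?_⟩
  have hpt : ∀ z ∈ D.Ω, ENNReal.ofReal (|f z / l| ^ p z) ≤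
      K.indicator (fun _ => ENNReal.ofReal (1 / (V + 1))) z := by
    intro z hz
    by_cases hzK : z ∈ K
    · rw [indicator_of_mem hzK]
      refine ENNReal.ofReal_le_ofReal ?_
      have h1 : |f z / l| ≤ 1 / (V + 1) := by
        rw [abs_div, abs_of_pos hlpos, hl, div_le_div_iff₀ (by positivity) (by positivity)]
        have : |f z| ≤ M' := (hM z hzK).trans (le_max_left _ _)
        nlinarith
      have h2 : 1 / (V + 1) ≤ 1 := by
        rw [div_le_one (by positivity)]; linarith
      calc |f z / l| ^ p z ≤ |f z / l| ^ (1 : ℝ) :=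
            Real.rpow_le_rpow_of_exponent_ge_of_imp (abs_nonneg _) (h1.trans h2) (hp z hz)
              (fun _ h => absurd h (by linarith [hp z hz]))
        _ ≤ 1 / (V + 1) := by rwa [Real.rpow_one]
    · rw [indicator_of_notMem hzK, hf0 z hzK]
      simp [Real.zero_rpow (by linarith [hp z hz] : p z ≠ 0)]
  calc varModular D.μ p (fun z => f z / l)
      ≤ ∫⁻ z, K.indicator (fun _ => ENNReal.ofReal (1 / (V + 1))) z ∂D.μ :=
        setLIntegral_mono' D.isOpen.measurableSet hpt
    _ ≤ ∫⁻ z, K.indicator (fun _ => ENNReal.ofReal (1 / (V + 1))) z :=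
        setLIntegral_le_lintegral _ _
    _ = ENNReal.ofReal (1 / (V + 1)) * volume K := by
        rw [lintegral_indicator_const hK.measurableSet]
    _ = ENNReal.ofReal (1 / (V + 1)) * ENNReal.ofReal V := by
        rw [hV, ENNReal.ofReal_toReal hK.measure_lt_top.ne]
    _ ≤ 1 := by
        rw [← ENNReal.ofReal_mul (by positivity), ← ENNReal.ofReal_one]
        refine ENNReal.ofReal_le_ofReal ?_
        rw [div_mul_eq_mul_div, one_mul, div_le_one (by positivity)]
        linarith

theorem aemeasurable_of_continuousOn {f : GrushinPt n m → ℝ} (hf : ContinuousOn f D.Ω) :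
    AEMeasurable f D.μ := hf.aemeasurable D.isOpen.measurableSet

theorem contG : ContinuousOn D.G D.Ω := D.contDiffOn_G.continuousOn

theorem A_nonneg (z : GrushinPt n m) : 0 ≤ D.A z := by
  unfold A; positivity

theorem contA : ContinuousOn D.A D.Ω := by
  unfold A
  refine (continuousOn_gradX D.isOpen D.contDiffOn_G).norm.add (ContinuousOn.mul ?_
    (continuousOn_gradY D.isOpen D.contDiffOn_G).norm)
  exact ContinuousOn.rpow_const (by fun_prop) fun _ _ => Or.inr D.γ_pos.le

theorem C1c.cont1 (u : D.C1c) : ContinuousOn (fun z => ‖gradX u z‖) D.Ω :=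
  (continuousOn_gradX D.isOpen u.contDiff.contDiffOn).norm

theorem C1c.cont2 (u : D.C1c) :
    ContinuousOn (fun z => ‖z.1‖ ^ (D.γ / D.G z) * ‖gradY u z‖) D.Ω := by
  refine ContinuousOn.mul ?_ (continuousOn_gradY D.isOpen u.contDiff.contDiffOn).norm
  refine ContinuousOn.rpow (by fun_prop)
    (continuousOn_const.div contG fun z hz => by linarith [D.two_lt_G z hz]) fun z hz => Or.inr ?_
  exact div_pos D.γ_pos (by linarith [D.two_lt_G z hz])

theorem C1c.cont3 (u : D.C1c) :
    ContinuousOn (fun z => u z * D.A z ^ (1 / (D.G z + 1))) D.Ω := by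
  refine u.contDiff.continuous.continuousOn.mul (contA.rpow
    (continuousOn_const.div (contG.add continuousOn_const) fun z hz => ?_) fun z hz => Or.inr ?_)
  · linarith [D.two_lt_G z hz]
  · exact div_pos one_pos (by linarith [D.two_lt_G z hz])

theorem C1c.cont4 (u : D.C1c) :
    ContinuousOn (fun z => u z * D.A z ^ (1 / (D.G z - 1))) D.Ω := by
  refine u.contDiff.continuous.continuousOn.mul (contA.rpow
    (continuousOn_const.div (contG.sub continuousOn_const) fun z hz => ?_) fun z hz => Or.inr ?_)
  · linarith [D.two_lt_G z hz]
  · exact div_pos one_pos (by linarith [D.two_lt_G z hz])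

theorem C1c.fin1 (u : D.C1c) :
    ∃ l : ℝ, 0 < l ∧ varModular D.μ D.G (fun z => ‖gradX u z‖ / l) ≤ 1 :=
  exists_modular_le (fun z hz => by linarith [D.two_lt_G z hz]) u.isCompact u.subset u.cont1
    fun z hz => by rw [gradX_of_notMem_tsupport u.differentiable hz, norm_zero]

theorem C1c.fin2 (u : D.C1c) : ∃ l : ℝ, 0 < l ∧
    varModular D.μ D.G (fun z => ‖z.1‖ ^ (D.γ / D.G z) * ‖gradY u z‖ / l) ≤ 1 :=
  exists_modular_le (fun z hz => by linarith [D.two_lt_G z hz]) u.isCompact u.subset u.cont2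
    fun z hz => by rw [gradY_of_notMem_tsupport u.differentiable hz, norm_zero, mul_zero]

theorem C1c.fin3 (u : D.C1c) : ∃ l : ℝ, 0 < l ∧ varModular D.μ (fun z => D.G z + 1)
    (fun z => u z * D.A z ^ (1 / (D.G z + 1)) / l) ≤ 1 :=
  exists_modular_le (fun z hz => by linarith [D.two_lt_G z hz]) u.isCompact u.subset u.cont3
    fun z hz => by rw [image_eq_zero_of_notMem_tsupport hz, zero_mul]

theorem C1c.fin4 (u : D.C1c) : ∃ l : ℝ, 0 < l ∧ varModular D.μ (fun z => D.G z - 1)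
    (fun z => u z * D.A z ^ (1 / (D.G z - 1)) / l) ≤ 1 :=
  exists_modular_le (fun z hz => by linarith [D.two_lt_G z hz]) u.isCompact u.subset u.cont4
    fun z hz => by rw [image_eq_zero_of_notMem_tsupport hz, zero_mul]

theorem ae_le (D : GrushinSetting n m) {p : GrushinPt n m → ℝ} (hp : ∀ z ∈ D.Ω, 1 ≤ p z) :
    ∀ᵐ z ∂D.μ, 1 ≤ p z :=
  (ae_restrict_mem D.isOpen.measurableSet).mono hp

theorem ae1 (D : GrushinSetting n m) : ∀ᵐ z ∂D.μ, 1 ≤ D.G z :=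
  D.ae_le fun z hz => by linarith [D.two_lt_G z hz]

theorem ae3 (D : GrushinSetting n m) : ∀ᵐ z ∂D.μ, 1 ≤ D.G z + 1 :=
  D.ae_le fun z hz => by linarith [D.two_lt_G z hz]

theorem ae4 (D : GrushinSetting n m) : ∀ᵐ z ∂D.μ, 1 ≤ D.G z - 1 :=
  D.ae_le fun z hz => by linarith [D.two_lt_G z hz]

theorem C1c.wNorm_nonneg (u : D.C1c) : 0 ≤ u.wNorm :=
  add_nonneg (add_nonneg (add_nonneg luxNorm_nonneg luxNorm_nonneg) luxNorm_nonneg)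
    luxNorm_nonneg

theorem C1c.wNorm_add_le (u v : D.C1c) : (u + v).wNorm ≤ u.wNorm + v.wNorm := by
  have hG := aemeasurable_of_continuousOn (D := D) contG
  have h1 := luxNorm_le_add (f := fun z => ‖gradX (u + v : D.C1c) z‖) D.ae1 hG
    (aemeasurable_of_continuousOn u.cont1) u.fin1 v.fin1 fun z => by
      rw [C1c.coe_add, gradX_add u.differentiable v.differentiable]
      simpa using norm_add_le _ _
  have h2 := luxNorm_le_add
    (f := fun z => ‖z.1‖ ^ (D.γ / D.G z) * ‖gradY (u + v : D.C1c) z‖) D.ae1 hG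
    (aemeasurable_of_continuousOn u.cont2) u.fin2 v.fin2 fun z => by
      rw [C1c.coe_add, gradY_add u.differentiable v.differentiable, abs_mul, abs_mul, abs_mul,
        ← mul_add]
      gcongr
      simpa using norm_add_le _ _
  have h3 := luxNorm_le_add
    (f := fun z => (u + v : D.C1c) z * D.A z ^ (1 / (D.G z + 1))) D.ae3 (hG.add_const 1)
    (aemeasurable_of_continuousOn u.cont3) u.fin3 v.fin3 fun z => by
      rw [C1c.coe_add, Pi.add_apply, add_mul]
      exact abs_add_le _ _
  have h4 := luxNorm_le_add
    (f := fun z => (u + v : D.C1c) z * D.A z ^ (1 / (D.G z - 1))) D.ae4 (hG.sub_const 1)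
    (aemeasurable_of_continuousOn u.cont4) u.fin4 v.fin4 fun z => by
      rw [C1c.coe_add, Pi.add_apply, add_mul]
      exact abs_add_le _ _
  unfold C1c.wNorm
  linarith

theorem C1c.wNorm_smul_le (c : ℝ) (u : D.C1c) : (c • u).wNorm ≤ ‖c‖ * u.wNorm := by
  have h1 := luxNorm_le_mul (f := fun z => ‖gradX (c • u : D.C1c) z‖) (c := c) D.ae1 u.fin1
    fun z => by
      rw [C1c.coe_smul, gradX_smul c u.differentiable, norm_smul, abs_mul]
      simp
  have h2 := luxNorm_le_mul (c := c)
    (f := fun z => ‖z.1‖ ^ (D.γ / D.G z) * ‖gradY (c • u : D.C1c) z‖) D.ae1 u.fin2 fun z => by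
      rw [C1c.coe_smul, gradY_smul c u.differentiable, norm_smul, ← abs_mul, mul_left_comm,
        abs_mul, Real.norm_eq_abs, abs_abs, abs_mul c]
  have h3 := luxNorm_le_mul (c := c)
    (f := fun z => (c • u : D.C1c) z * D.A z ^ (1 / (D.G z + 1))) D.ae3 u.fin3 fun z => by
      rw [C1c.coe_smul, Pi.smul_apply, smul_eq_mul, mul_assoc, abs_mul]
  have h4 := luxNorm_le_mul (c := c)
    (f := fun z => (c • u : D.C1c) z * D.A z ^ (1 / (D.G z - 1))) D.ae4 u.fin4 fun z => by
      rw [C1c.coe_smul, Pi.smul_apply, smul_eq_mul, mul_assoc, abs_mul]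
  unfold C1c.wNorm
  rw [Real.norm_eq_abs]
  linarith

variable (D)

/-- The norm of `W` as a seminorm on `C¹_c(Ω)`. -/
def wSeminorm : Seminorm ℝ D.C1c :=
  Seminorm.ofSMulLE C1c.wNorm
    (le_antisymm (by simpa using C1c.wNorm_smul_le 0 (0 : D.C1c)) (C1c.wNorm_nonneg _))
    C1c.wNorm_add_le C1c.wNorm_smul_le

instance : SeminormedAddCommGroup D.C1c := D.wSeminorm.toSeminormedAddCommGroup

instance : NormedSpace ℝ D.C1c where
  norm_smul_le c u := C1c.wNorm_smul_le c u

/-- The space `W`: the completion of `C¹_c(Ω)` with respect to `C1c.wNorm`. -/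
abbrev W : Type := UniformSpace.Completion D.C1c

end GrushinSetting

end

/-! Compactness is a Kolmogorov–Riesz argument on the unit ball of `C1c`, and it rests on the two
gradient terms. Since `Ω` has finite measure, a modular bound with exponent `G` gives a bound in
`L^q` for every constant `1 ≤ q ≤ G⁻`, and the variable exponent then plays no further role. The
gradient in `x` carries no weight, so it controls `x`-translates, and a translation in `x` longer
than the diameter of `Ω` gives Poincaré's inequality (`exists_lintegral_rpow_le`), hence a bound in
`L^{G⁻}`.

The `y`-gradient is degenerate only at `x = 0`. Where `|x| ≥ ε` its weight is at least `ε^γ`, so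
`y`-translates are controlled there. On the strip `|x| < ε`, Hölder's inequality with `s < G⁻` makes
the `L^s` mass uniformly small, because the part of `Ω` in the strip has small measure. Both regions
are invariant under `y`-translation, so the estimates combine into equicontinuity of translations
(`exists_translate_sub_le`), and `exists_finite_discretization` yields total boundedness.

Injectivity on the completion is closability of the norm (`tendsto_norm_zero`): a `W`-Cauchy
sequence tending to zero in `L¹` tends to zero in `W`. The weighted gradients have `L¹` limits;
testing against functions supported where the weight is positive and integrating by parts shows that
these limits vanish. Along a subsequence everything tends to zero almost everywhere, and Fatou's
lemma applied to the modular of `u_k - u_j` as `j → ∞` bounds each term of `‖u_k‖`. -/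

/-! ### Elementary inequalities for powers and averages -/

theorem ENNReal.exists_pos_mul_le {a e : ℝ≥0∞} (ha : a ≠ ⊤) (he : 0 < e) :
    ∃ d : ℝ≥0∞, 0 < d ∧ d ≠ ⊤ ∧ a * d ≤ e := by
  -- Truncating `e` at 1 keeps the witness finite when `e = ⊤`; the `+ 1` covers `a = 0`.
  refine ⟨min e 1 / (a + 1), ?_, ?_, ?_⟩
  · exact ENNReal.div_pos (by simp [he.ne']) (by simp [ha])
  · exact (ENNReal.div_lt_top (by simp) (by simp)).ne
  · calc a * (min e 1 / (a + 1)) ≤ (a + 1) * (min e 1 / (a + 1)) := by gcongr; exact le_self_add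
      _ = min e 1 := ENNReal.mul_div_cancel (by simp) (by simp [ha])
      _ ≤ e := min_le_left _ _

theorem ENNReal.add_add_rpow_le {s : ℝ} (hs : 0 ≤ s) (a b c : ℝ≥0∞) :
    (a + b + c) ^ s ≤ 3 ^ s * (a ^ s + b ^ s + c ^ s) := by
  have h : a + b + c ≤ 3 * max a (max b c) := by
    calc a + b + c ≤ max a (max b c) + max a (max b c) + max a (max b c) := by
          gcongr <;> simp
      _ = 3 * max a (max b c) := by ring
  refine (ENNReal.rpow_le_rpow h hs).trans ?_
  rw [ENNReal.mul_rpow_of_nonneg _ _ hs]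
  gcongr
  rcases le_total b c with h1 | h1 <;> simp only [h1, sup_of_le_left, sup_of_le_right]
  · rcases le_total a c with h2 | h2 <;> simp only [h2, sup_of_le_left, sup_of_le_right]
    · exact le_add_self
    · exact le_self_add.trans le_self_add
  · rcases le_total a b with h2 | h2 <;> simp only [h2, sup_of_le_left, sup_of_le_right]
    · exact le_add_self.trans le_self_add
    · exact le_self_add.trans le_self_add

theorem enorm_sub_rpow_le {F : Type*} [NormedAddCommGroup F] {s : ℝ} (hs : 0 ≤ s)
    (a b c d : F) :
    ‖a - d‖ₑ ^ s ≤ 3 ^ s * (‖a - b‖ₑ ^ s + ‖b - c‖ₑ ^ s + ‖c - d‖ₑ ^ s) := by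
  refine le_trans (ENNReal.rpow_le_rpow ?_ hs) (ENNReal.add_add_rpow_le hs _ _ _)
  have : a - d = a - b + (b - c) + (c - d) := by abel
  rw [this]
  calc ‖a - b + (b - c) + (c - d)‖ₑ ≤ ‖a - b + (b - c)‖ₑ + ‖c - d‖ₑ := enorm_add_le _ _
    _ ≤ ‖a - b‖ₑ + ‖b - c‖ₑ + ‖c - d‖ₑ := by gcongr; exact enorm_add_le _ _

/-- Jensen's inequality for `t ↦ t ^ s`. -/
theorem lintegral_enorm_rpow_le {α F : Type*} [MeasurableSpace α] [NormedAddCommGroup F]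
    {ν : Measure α} [IsProbabilityMeasure ν] {s : ℝ} (hs : 1 ≤ s) {g : α → F}
    (hg : AEStronglyMeasurable g ν) :
    (∫⁻ a, ‖g a‖ₑ ∂ν) ^ s ≤ ∫⁻ a, ‖g a‖ₑ ^ s ∂ν := by
  have hs0 : 0 < s := by linarith
  have h := eLpNorm_le_eLpNorm_of_exponent_le (ENNReal.one_le_ofReal.2 hs) hg
  rw [eLpNorm_one_eq_lintegral_enorm, eLpNorm_eq_lintegral_rpow_enorm_toReal
    (by simpa using hs0) ENNReal.ofReal_ne_top, ENNReal.toReal_ofReal hs0.le] at h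
  have h2 := ENNReal.rpow_le_rpow h hs0.le
  rwa [← ENNReal.rpow_mul, one_div_mul_cancel hs0.ne', ENNReal.rpow_one] at h2

theorem enorm_integral_rpow_le {α F : Type*} [MeasurableSpace α] [NormedAddCommGroup F]
    [NormedSpace ℝ F] {ν : Measure α} [IsProbabilityMeasure ν] {s : ℝ} (hs : 1 ≤ s) {g : α → F}
    (hg : AEStronglyMeasurable g ν) :
    ‖∫ a, g a ∂ν‖ₑ ^ s ≤ ∫⁻ a, ‖g a‖ₑ ^ s ∂ν :=
  (ENNReal.rpow_le_rpow (enorm_integral_le_lintegral_enorm g) (by linarith)).trans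
    (lintegral_enorm_rpow_le hs hg)

/-! ### Kolmogorov–Riesz compactness by averaging over small balls -/

section Mean

universe v

variable {E : Type v} [NormedAddCommGroup E] [NormedSpace ℝ E] [FiniteDimensional ℝ E]
  [MeasurableSpace E] [BorelSpace E] {μ : Measure E} [μ.IsAddHaarMeasure]

/-- Normalized Haar measure on a small ball. The domination by `c • μ` turns averages into pointwise
bounds by integrals over the whole space. -/
theorem exists_isProbabilityMeasure_le_smul (μ : Measure E) [μ.IsAddHaarMeasure] {δ : ℝ}
    (hδ : 0 < δ) :
    ∃ (ν : Measure E) (c : ℝ≥0∞), IsProbabilityMeasure ν ∧ c ≠ ⊤ ∧ ν ≤ c • μ ∧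
      ∀ᵐ h ∂ν, ‖h‖ < δ := by
  have h0 : μ (Metric.ball 0 δ) ≠ 0 := (Metric.measure_ball_pos μ 0 hδ).ne'
  have h1 : μ (Metric.ball 0 δ) ≠ ⊤ := measure_ball_lt_top.ne
  refine ⟨ProbabilityTheory.cond μ (Metric.ball 0 δ), (μ (Metric.ball 0 δ))⁻¹,
    ProbabilityTheory.cond_isProbabilityMeasure_of_finite h0 h1, by simpa using h0, ?_, ?_⟩
  · unfold ProbabilityTheory.cond
    gcongr
    exact Measure.restrict_le_self
  · unfold ProbabilityTheory.cond
    refine Measure.ae_smul_measure ?_ _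
    filter_upwards [ae_restrict_mem measurableSet_ball] with h hh
    simpa using hh

variable {ν : Measure E} [IsProbabilityMeasure ν] {c : ℝ≥0∞} {s : ℝ} {f : E → ℝ}

theorem integrable_translate (hf : Continuous f) (hfc : HasCompactSupport f) (z : E) :
    Integrable (fun h => f (z + h)) ν :=
  (hf.comp (continuous_const.add continuous_id)).integrable_of_hasCompactSupport
    (hfc.comp_homeomorph (Homeomorph.addLeft z))

/-- The error is the average of the increments `f (z + h) - f z`, so Jensen and Tonelli reduce it to
the translation bound for each `h`. -/
theorem lintegral_sub_mean_le (hs : 1 ≤ s) (hf : Continuous f) (hfc : HasCompactSupport f)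
    {e : ℝ≥0∞} (he : ∀ᵐ h ∂ν, ∫⁻ z, ‖f (z + h) - f z‖ₑ ^ s ∂μ ≤ e) :
    ∫⁻ z, ‖f z - ∫ h, f (z + h) ∂ν‖ₑ ^ s ∂μ ≤ e := by
  have hm : Measurable (fun q : E × E => ‖f (q.1 + q.2) - f q.1‖ₑ ^ s) := by
    have : Continuous (fun q : E × E => f (q.1 + q.2) - f q.1) := by fun_prop
    exact this.measurable.enorm.pow_const s
  calc ∫⁻ z, ‖f z - ∫ h, f (z + h) ∂ν‖ₑ ^ s ∂μ
      ≤ ∫⁻ z, ∫⁻ h, ‖f (z + h) - f z‖ₑ ^ s ∂ν ∂μ := by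
        refine lintegral_mono fun z => ?_
        have : f z - ∫ h, f (z + h) ∂ν = -∫ h, (f (z + h) - f z) ∂ν := by
          rw [integral_sub (integrable_translate hf hfc z) (integrable_const _)]
          simp
        simp only [this, enorm_neg]
        exact enorm_integral_rpow_le hs
          ((integrable_translate hf hfc z).sub (integrable_const _)).aestronglyMeasurable
    _ = ∫⁻ h, ∫⁻ z, ‖f (z + h) - f z‖ₑ ^ s ∂μ ∂ν :=
        lintegral_lintegral_swap hm.aemeasurable
    _ ≤ ∫⁻ _, e ∂ν := lintegral_mono_ae he
    _ = e := by simp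

/-- Once `ν` is replaced by `c • μ`, recentring at `w` leaves a single translation by `z - w`. This
makes the averages equicontinuous in the sup norm. -/
theorem enorm_mean_sub_mean_le (hs : 1 ≤ s) (hf : Continuous f) (hfc : HasCompactSupport f)
    (hν : ν ≤ c • μ) {e : ℝ≥0∞} {z w : E}
    (he : ∫⁻ x, ‖f (x + (z - w)) - f x‖ₑ ^ s ∂μ ≤ e) :
    ‖∫ h, f (z + h) ∂ν - ∫ h, f (w + h) ∂ν‖ₑ ^ s ≤ c * e := by
  rw [← integral_sub (integrable_translate hf hfc z) (integrable_translate hf hfc w)]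
  calc _ ≤ ∫⁻ h, ‖f (z + h) - f (w + h)‖ₑ ^ s ∂ν := enorm_integral_rpow_le hs
          ((integrable_translate hf hfc z).sub
            (integrable_translate hf hfc w)).aestronglyMeasurable
    _ ≤ ∫⁻ h, ‖f (z + h) - f (w + h)‖ₑ ^ s ∂(c • μ) := lintegral_mono' hν le_rfl
    _ = c * ∫⁻ h, ‖f (z + h) - f (w + h)‖ₑ ^ s ∂μ := by rw [lintegral_smul_measure, smul_eq_mul]
    _ = c * ∫⁻ x, ‖f (x + (z - w)) - f x‖ₑ ^ s ∂μ := by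
        rw [← lintegral_add_left_eq_self (μ := μ) (fun x => ‖f (x + (z - w)) - f x‖ₑ ^ s) w]
        congr 1
        refine lintegral_congr fun h => ?_
        rw [show w + h + (z - w) = z + h by abel]
    _ ≤ c * e := by gcongr

theorem enorm_mean_le (hs : 1 ≤ s) (hf : Continuous f) (hfc : HasCompactSupport f)
    (hν : ν ≤ c • μ) (z : E) :
    ‖∫ h, f (z + h) ∂ν‖ₑ ^ s ≤ c * ∫⁻ x, ‖f x‖ₑ ^ s ∂μ := by
  calc _ ≤ ∫⁻ h, ‖f (z + h)‖ₑ ^ s ∂ν := enorm_integral_rpow_le hs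
          (integrable_translate hf hfc z).aestronglyMeasurable
    _ ≤ ∫⁻ h, ‖f (z + h)‖ₑ ^ s ∂(c • μ) := lintegral_mono' hν le_rfl
    _ = c * ∫⁻ h, ‖f (z + h)‖ₑ ^ s ∂μ := by rw [lintegral_smul_measure, smul_eq_mul]
    _ = _ := by rw [lintegral_add_left_eq_self (fun x => ‖f x‖ₑ ^ s) z]

theorem exists_finite_discretization_of_bounded {ι : Type*} {κ : Type v} [Finite κ] (v : ι → κ → ℝ) {R : ℝ}
    (hR : ∀ i k, |v i k| ≤ R) {ρ : ℝ} (hρ : 0 < ρ) :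
    ∃ (β : Type v) (_ : Finite β) (F : ι → β), ∀ i j, F i = F j → ∀ k, |v i k - v j k| < ρ := by
  have := Fintype.ofFinite κ
  -- The absolute value makes the radius nonnegative, since `R` may be negative when `ι` or `κ` is
  -- empty.
  have hK : TotallyBounded (Metric.closedBall (0 : κ → ℝ) |R|) :=
    (isCompact_closedBall _ _).totallyBounded
  obtain ⟨t, ht, hcov⟩ := Metric.totallyBounded_iff.1 hK (ρ / 2) (by positivity)
  have hex : ∀ i, ∃ y : t, dist (v i) y < ρ / 2 := by
    intro i
    have : v i ∈ Metric.closedBall (0 : κ → ℝ) |R| := by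
      rw [mem_closedBall_zero_iff, pi_norm_le_iff_of_nonneg (abs_nonneg R)]
      exact fun k => (hR i k).trans (le_abs_self R)
    obtain ⟨y, hy, h⟩ := mem_iUnion₂.1 (hcov this)
    exact ⟨⟨y, hy⟩, h⟩
  choose F hF using hex
  refine ⟨t, ht, F, fun i j hij k => ?_⟩
  have h1 : dist (v i) (v j) < ρ := by
    have := hF j
    rw [← hij] at this
    linarith [dist_triangle_right (v i) (v j) (F i), hF i]
  rw [← Real.dist_eq]
  exact (dist_le_pi_dist _ _ k).trans_lt h1

/-- A Kolmogorov–Riesz criterion. -/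
theorem exists_finite_discretization {ι : Type*} (f : ι → E → ℝ) (hs : 1 ≤ s)
    (hf : ∀ i, Continuous (f i)) (hfc : ∀ i, HasCompactSupport (f i)) {C : ℝ≥0∞} (hC : C ≠ ⊤)
    (hfC : ∀ i, ∫⁻ z, ‖f i z‖ₑ ^ s ∂μ ≤ C)
    (heq : ∀ e : ℝ≥0∞, 0 < e → ∃ δ : ℝ, 0 < δ ∧ ∀ i h, ‖h‖ < δ →
      ∫⁻ z, ‖f i (z + h) - f i z‖ₑ ^ s ∂μ ≤ e)
    {K : Set E} (hK : Bornology.IsBounded K) (hKm : MeasurableSet K) {e : ℝ≥0∞} (he : 0 < e) :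
    ∃ (β : Type v) (_ : Finite β) (F : ι → β), ∀ i j, F i = F j →
      ∫⁻ z in K, ‖f i z - f j z‖ₑ ^ s ∂μ ≤ e := by
  have hs0 : 0 < s := by linarith
  have h3 : (3 : ℝ≥0∞) ^ s ≠ ⊤ := ENNReal.rpow_ne_top_of_nonneg hs0.le (by simp)
  -- Error budget: `e1` bounds each of the three integrals in the final triangle inequality, `e2`
  -- the difference of averages pointwise on `K`, and `e3` each of the three pointwise errors behind
  -- `e2`. The tolerance `e4` comes last: it depends on `c`, hence on the averaging radius `δ`.
  obtain ⟨e1, he1, he1t, hee1⟩ := ENNReal.exists_pos_mul_le (a := 3 ^ s * 3)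
    (ENNReal.mul_ne_top h3 (by simp)) he
  have hKt : μ K ≠ ⊤ := hK.measure_lt_top.ne
  obtain ⟨e2, he2, he2t, hee2⟩ := ENNReal.exists_pos_mul_le (a := μ K) hKt he1
  obtain ⟨e3, he3, he3t, hee3⟩ := ENNReal.exists_pos_mul_le (a := 3 ^ s * 3)
    (ENNReal.mul_ne_top h3 (by simp)) he2
  obtain ⟨δ, hδ, hδf⟩ := heq e1 he1
  obtain ⟨ν, c, hν, hc, hνc, hνδ⟩ := exists_isProbabilityMeasure_le_smul μ hδ
  obtain ⟨e4, he4, he4t, hee4⟩ := ENNReal.exists_pos_mul_le hc he3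
  obtain ⟨η, hη, hηf⟩ := heq e4 he4
  obtain ⟨t, ht, hcov⟩ := Metric.totallyBounded_iff.1 (hK.isCompact_closure.totallyBounded.subset subset_closure) η hη
  have : Finite t := ht
  set M : ι → E → ℝ := fun i z => ∫ h, f i (z + h) ∂ν with hM
  have hMb : ∀ i z, |M i z| ≤ ((c * C) ^ s⁻¹).toReal := by
    intro i z
    have h1 : ‖M i z‖ₑ ^ s ≤ c * C := (enorm_mean_le hs (hf i) (hfc i) hνc z).trans
      (by gcongr; exact hfC i)
    have h2 : ‖M i z‖ₑ ≤ (c * C) ^ s⁻¹ := (ENNReal.le_rpow_inv_iff hs0).2 h1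
    rw [← Real.norm_eq_abs, ← toReal_enorm]
    exact ENNReal.toReal_mono
      (ENNReal.rpow_ne_top_of_nonneg (by positivity) (ENNReal.mul_ne_top hc hC)) h2
  have hρ : 0 < (e3 ^ s⁻¹).toReal := ENNReal.toReal_pos
    (ENNReal.rpow_pos he3 he3t).ne' (ENNReal.rpow_ne_top_of_nonneg (by positivity) he3t)
  obtain ⟨β, hβ, F, hF⟩ := exists_finite_discretization_of_bounded (fun i (k : t) => M i k)
    (fun i k => hMb i k) hρ
  refine ⟨β, hβ, F, fun i j hij => ?_⟩
  -- Compare at a point `w` of the finite `η`-net: the averages vary little between `z` and `w`, and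
  -- equal labels make them close at `w`.
  have hmid : ∀ z ∈ K, ‖M i z - M j z‖ₑ ^ s ≤ e2 := by
    intro z hz
    obtain ⟨w, hw, hzw⟩ := mem_iUnion₂.1 (hcov hz)
    rw [Metric.mem_ball, dist_eq_norm] at hzw
    have a1 : ‖M i z - M i w‖ₑ ^ s ≤ e3 :=
      (enorm_mean_sub_mean_le hs (hf i) (hfc i) hνc (hηf i _ hzw)).trans hee4
    have a3 : ‖M j w - M j z‖ₑ ^ s ≤ e3 := by
      rw [← neg_sub, norm_neg] at hzw
      refine (enorm_mean_sub_mean_le hs (hf j) (hfc j) hνc (hηf j _ ?_)).trans hee4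
      exact hzw
    have a2 : ‖M i w - M j w‖ₑ ^ s ≤ e3 := by
      rw [← ENNReal.le_rpow_inv_iff hs0]
      have h1 := (hF i j hij ⟨w, hw⟩).le
      rw [← Real.norm_eq_abs, ← toReal_enorm] at h1
      exact (ENNReal.toReal_le_toReal enorm_ne_top
        (ENNReal.rpow_ne_top_of_nonneg (by positivity) he3t)).1 h1
    calc _ ≤ _ := enorm_sub_rpow_le hs0.le _ (M i w) (M j w) _
      _ ≤ 3 ^ s * (e3 + e3 + e3) := by gcongr
      _ = 3 ^ s * 3 * e3 := by ring
      _ ≤ e2 := hee3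
  have hout : ∀ i, ∫⁻ z in K, ‖f i z - M i z‖ₑ ^ s ∂μ ≤ e1 := fun i =>
    (setLIntegral_le_lintegral _ _).trans (lintegral_sub_mean_le hs (hf i) (hfc i)
      (hνδ.mono fun h hh => hδf i h hh))
  have hMc : ∀ i, Measurable (M i) := fun i => by
    have : Continuous (fun q : E × E => f i (q.1 + q.2)) := by have := hf i; fun_prop
    exact this.stronglyMeasurable.integral_prod_right.measurable
  calc ∫⁻ z in K, ‖f i z - f j z‖ₑ ^ s ∂μ
      ≤ ∫⁻ z in K, 3 ^ s * (‖f i z - M i z‖ₑ ^ s + ‖M i z - M j z‖ₑ ^ s +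
          ‖f j z - M j z‖ₑ ^ s) ∂μ := by
        refine lintegral_mono fun z => ?_
        rw [← enorm_neg (f j z - M j z), neg_sub]
        exact enorm_sub_rpow_le hs0.le _ (M i z) (M j z) _
    _ = 3 ^ s * (∫⁻ z in K, ‖f i z - M i z‖ₑ ^ s ∂μ + ∫⁻ z in K, ‖M i z - M j z‖ₑ ^ s ∂μ +
          ∫⁻ z in K, ‖f j z - M j z‖ₑ ^ s ∂μ) := by
        rw [lintegral_const_mul' _ _ h3, lintegral_add_right, lintegral_add_right]
        · exact ((hMc i).sub (hMc j)).enorm.pow_const s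
        · exact ((hf j).measurable.sub (hMc j)).enorm.pow_const s
    _ ≤ 3 ^ s * (e1 + e1 + e1) := by
        gcongr
        · exact hout i
        · calc _ ≤ ∫⁻ z in K, e2 ∂μ := setLIntegral_mono' hKm hmid
            _ = μ K * e2 := by rw [setLIntegral_const, mul_comm]
            _ ≤ e1 := hee2
        · exact hout j
    _ = 3 ^ s * 3 * e1 := by ring
    _ ≤ e := hee1

end Mean

/-! ### Modulars, Luxemburg norms and Fatou's lemma -/

theorem ENNReal.exists_pos_ofReal_rpow_le {a e : ℝ≥0∞} (ha : a ≠ ⊤) (he : 0 < e) {s : ℝ}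
    (hs : 0 < s) : ∃ δ : ℝ, 0 < δ ∧ a * ENNReal.ofReal δ ^ s ≤ e := by
  obtain ⟨d, hd, hdt, h⟩ := ENNReal.exists_pos_mul_le ha he
  have ht : d ^ s⁻¹ ≠ ⊤ := ENNReal.rpow_ne_top_of_nonneg (by positivity) hdt
  refine ⟨(d ^ s⁻¹).toReal, ENNReal.toReal_pos (ENNReal.rpow_pos hd hdt).ne' ht, ?_⟩
  rwa [ENNReal.ofReal_toReal ht, ENNReal.rpow_inv_rpow hs.ne']

theorem enorm_rpow_le_one_add {F : Type*} [SeminormedAddCommGroup F] {q p : ℝ} (hq : 0 ≤ q)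
    (hqp : q ≤ p) (x : F) : ‖x‖ₑ ^ q ≤ 1 + ‖x‖ₑ ^ p := by
  rcases le_total ‖x‖ₑ 1 with h | h
  · exact (ENNReal.rpow_le_one h hq).trans le_self_add
  · exact (ENNReal.rpow_le_rpow_of_exponent_le h hqp).trans le_add_self

section Lux

variable {α : Type*} [MeasurableSpace α] {μ : Measure α} {p f : α → ℝ}

/-- Some admissible `k` lies below `l`, and the modular of `f / l` decreases as `l` grows. -/
theorem varModular_div_le_one_of_luxNorm_lt {l : ℝ} (hp : ∀ᵐ z ∂μ, 1 ≤ p z)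
    (hf : ∃ l : ℝ, 0 < l ∧ varModular μ p (fun z => f z / l) ≤ 1) (h : luxNorm μ p f < l) :
    varModular μ p (fun z => f z / l) ≤ 1 := by
  obtain ⟨k, ⟨hk, hk1⟩, hkl⟩ := exists_lt_of_csInf_lt hf h
  refine le_trans (lintegral_mono_ae ?_) hk1
  filter_upwards [hp] with z hz
  refine ENNReal.ofReal_le_ofReal (Real.rpow_le_rpow (abs_nonneg _) ?_ (by linarith))
  rw [abs_div, abs_div, abs_of_pos hk, abs_of_pos (hk.trans hkl)]
  gcongr

theorem luxNorm_le_of_varModular {l : ℝ} (hl : 0 < l)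
    (h : varModular μ p (fun z => f z / l) ≤ 1) : luxNorm μ p f ≤ l :=
  csInf_le ⟨0, fun _ hl => hl.1.le⟩ ⟨hl, h⟩

/-- Passage from the variable exponent to a constant one, by `|t|^q ≤ 1 + |t|^p` for `q ≤ p`. -/
theorem lintegral_enorm_rpow_le_of_varModular {q : ℝ} (hq : 0 ≤ q) (hp : ∀ᵐ z ∂μ, q ≤ p z)
    (h : varModular μ p f ≤ 1) : ∫⁻ z, ‖f z‖ₑ ^ q ∂μ ≤ μ univ + 1 := by
  calc ∫⁻ z, ‖f z‖ₑ ^ q ∂μ ≤ ∫⁻ z, (1 + ENNReal.ofReal (|f z| ^ p z)) ∂μ := by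
        refine lintegral_mono_ae ?_
        filter_upwards [hp] with z hz
        rw [← ENNReal.ofReal_rpow_of_nonneg (abs_nonneg _) (hq.trans hz), ← Real.enorm_eq_ofReal_abs]
        exact enorm_rpow_le_one_add hq hz _
    _ = μ univ + varModular μ p f := by
        rw [lintegral_add_left measurable_const]; simp [varModular]
    _ ≤ μ univ + 1 := by gcongr

/-- Fatou's lemma for the modular. -/
theorem varModular_le_of_tendsto {F : ℕ → α → ℝ} {C : ℝ≥0∞} (hp : ∀ᵐ z ∂μ, 1 ≤ p z)
    (hpm : AEMeasurable p μ) (hF : ∀ j, AEMeasurable (F j) μ) (hFC : ∀ j, varModular μ p (F j) ≤ C)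
    (h : ∀ᵐ z ∂μ, Tendsto (fun j => F j z) atTop (𝓝 (f z))) : varModular μ p f ≤ C := by
  calc varModular μ p f
      = ∫⁻ z, liminf (fun j => ENNReal.ofReal (|F j z| ^ p z)) atTop ∂μ := by
        refine lintegral_congr_ae ?_
        filter_upwards [h, hp] with z hz hpz
        refine (Tendsto.liminf_eq ?_).symm
        exact (ENNReal.continuous_ofReal.tendsto _).comp
          (hz.abs.rpow_const (Or.inr (by linarith)))
    _ ≤ liminf (fun j => varModular μ p (F j)) atTop := by
        refine lintegral_liminf_le' fun j => ?_
        have : AEMeasurable (fun z => |F j z|) μ := by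
          simpa only [Real.norm_eq_abs] using (hF j).norm
        exact (this.pow hpm).ennreal_ofReal
    _ ≤ C := by
        refine (liminf_le_liminf (Eventually.of_forall hFC)).trans ?_
        simp

end Lux

/-! ### Translation estimates from directional derivatives -/

section Translation

theorem setLIntegral_translate {V : Type*} [AddGroup V] [MeasurableSpace V] [MeasurableAdd V]
    {μ : Measure V} [μ.IsAddRightInvariant] {S : Set V} (hSm : MeasurableSet S) {v : V}
    (hS : ∀ z, z + v ∈ S ↔ z ∈ S) (g : V → ℝ≥0∞) :
    ∫⁻ z in S, g (z + v) ∂μ = ∫⁻ z in S, g z ∂μ := by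
  rw [← lintegral_indicator hSm, ← lintegral_indicator hSm,
    ← lintegral_add_right_eq_self (S.indicator g) v]
  refine lintegral_congr fun z => ?_
  by_cases hz : z ∈ S
  · rw [indicator_of_mem hz, indicator_of_mem ((hS z).2 hz)]
  · rw [indicator_of_notMem hz, indicator_of_notMem (fun h => hz ((hS z).1 h))]

variable {E : Type*} [NormedAddCommGroup E] [NormedSpace ℝ E] [FiniteDimensional ℝ E]
  [MeasurableSpace E] [BorelSpace E] {μ : Measure E} [μ.IsAddHaarMeasure]

/-- Write the increment as the integral of the derivative along the segment, then apply Jensen on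
`(0, 1]` and Tonelli. Invariance of `S` under every `t • v` removes the shift in the inner integral.
-/
theorem setLIntegral_translate_sub_le {q : ℝ} (hq : 1 ≤ q) {u : E → ℝ} (hu : ContDiff ℝ 1 u)
    {S : Set E} (hSm : MeasurableSet S) {v : E} (hS : ∀ (t : ℝ) z, z + t • v ∈ S ↔ z ∈ S) :
    ∫⁻ z in S, ‖u (z + v) - u z‖ₑ ^ q ∂μ ≤ ∫⁻ z in S, ‖fderiv ℝ u z v‖ₑ ^ q ∂μ := by
  have hfd : Continuous (fderiv ℝ u) := hu.continuous_fderiv one_ne_zero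
  have hprob : IsProbabilityMeasure (volume.restrict (Ioc (0 : ℝ) 1)) := ⟨by simp⟩
  have hc : Continuous fun r : E × ℝ => fderiv ℝ u (r.1 + r.2 • v) v :=
    (hfd.comp (by fun_prop)).clm_apply continuous_const
  have hftc : ∀ z, u (z + v) - u z = ∫ t in Ioc (0 : ℝ) 1, fderiv ℝ u (z + t • v) v := by
    intro z
    have hcz : Continuous fun t : ℝ => fderiv ℝ u (z + t • v) v :=
      hc.comp (Continuous.prodMk_right z)
    have := intervalIntegral.integral_eq_sub_of_hasDerivAt (a := 0) (b := 1)
      (f := fun t : ℝ => u (z + t • v)) (f' := fun t => fderiv ℝ u (z + t • v) v)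
      (fun t _ => by
        have h1 : HasDerivAt (fun t : ℝ => z + t • v) v t := by
          simpa using ((hasDerivAt_id t).smul_const v).const_add z
        exact ((hu.differentiable one_ne_zero _).hasFDerivAt).comp_hasDerivAt t h1)
      (hcz.intervalIntegrable _ _)
    rw [intervalIntegral.integral_of_le zero_le_one] at this
    simpa using this.symm
  calc ∫⁻ z in S, ‖u (z + v) - u z‖ₑ ^ q ∂μ
      ≤ ∫⁻ z in S, (∫⁻ t in Ioc (0 : ℝ) 1, ‖fderiv ℝ u (z + t • v) v‖ₑ ^ q) ∂μ := by
        refine lintegral_mono fun z => ?_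
        simp only [hftc z]
        exact enorm_integral_rpow_le hq
          (hc.comp (Continuous.prodMk_right z)).aestronglyMeasurable
    _ = ∫⁻ t in Ioc (0 : ℝ) 1, ∫⁻ z in S, ‖fderiv ℝ u (z + t • v) v‖ₑ ^ q ∂μ :=
        lintegral_lintegral_swap (hc.measurable.enorm.pow_const q).aemeasurable
    _ = ∫⁻ t in Ioc (0 : ℝ) 1, ∫⁻ z in S, ‖fderiv ℝ u z v‖ₑ ^ q ∂μ := by
        refine lintegral_congr fun t => ?_
        exact setLIntegral_translate hSm (hS t) fun z => ‖fderiv ℝ u z v‖ₑ ^ q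
    _ = _ := by simp

end Translation

theorem lintegral_eq_setLIntegral {α : Type*} [MeasurableSpace α] {μ : Measure α} {S : Set α}
    (hS : MeasurableSet S) {g : α → ℝ≥0∞} (hg : ∀ z ∉ S, g z = 0) :
    ∫⁻ z, g z ∂μ = ∫⁻ z in S, g z ∂μ := by
  rw [← lintegral_indicator hS, indicator_eq_self.2 (Function.support_subset_iff'.2 hg)]

/-- Hölder's inequality against an indicator function. -/
theorem lintegral_enorm_rpow_le_mul_measure {α F : Type*} [MeasurableSpace α] {ν : Measure α}
    [NormedAddCommGroup F] {s r : ℝ} (hs : 0 < s) (hsr : s ≤ r) {f : α → F}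
    (hf : AEStronglyMeasurable f ν) :
    ∫⁻ z, ‖f z‖ₑ ^ s ∂ν ≤ (∫⁻ z, ‖f z‖ₑ ^ r ∂ν) ^ (s / r) * ν univ ^ (1 - s / r) := by
  have hr : 0 < r := hs.trans_le hsr
  have h := eLpNorm_le_eLpNorm_mul_rpow_measure_univ (ENNReal.ofReal_le_ofReal hsr) hf
  rw [eLpNorm_eq_lintegral_rpow_enorm_toReal (by simpa using hs) ENNReal.ofReal_ne_top,
    eLpNorm_eq_lintegral_rpow_enorm_toReal (by simpa using hr) ENNReal.ofReal_ne_top,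
    ENNReal.toReal_ofReal hs.le, ENNReal.toReal_ofReal hr.le] at h
  have h2 := ENNReal.rpow_le_rpow h hs.le
  rwa [ENNReal.mul_rpow_of_nonneg _ _ hs.le, ← ENNReal.rpow_mul, ← ENNReal.rpow_mul,
    ← ENNReal.rpow_mul, one_div_mul_cancel hs.ne', ENNReal.rpow_one,
    one_div_mul_eq_div, sub_mul, one_div_mul_cancel hs.ne', one_div_mul_eq_div] at h2

/-! ### Uniform estimates on the unit ball of `W` -/

theorem norm_gradX {n m : ℕ} {u : GrushinPt n m → ℝ} {z : GrushinPt n m}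
    (h : DifferentiableAt ℝ u z) :
    ‖gradX u z‖ = ‖(fderiv ℝ u z).comp (ContinuousLinearMap.inl ℝ _ _)‖ := by
  rw [gradX_eq h, LinearIsometryEquiv.norm_map]

theorem norm_gradY {n m : ℕ} {u : GrushinPt n m → ℝ} {z : GrushinPt n m}
    (h : DifferentiableAt ℝ u z) :
    ‖gradY u z‖ = ‖(fderiv ℝ u z).comp (ContinuousLinearMap.inr ℝ _ _)‖ := by
  rw [gradY_eq h, LinearIsometryEquiv.norm_map]

instance GrushinPt.isAddHaarMeasure_volume {n m : ℕ} :
    (volume : Measure (GrushinPt n m)).IsAddHaarMeasure :=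
  Measure.prod.instIsAddHaarMeasure _ _

theorem GrushinPt.volume_fst_eq_zero {n m : ℕ} (hn : 0 < n) :
    volume {z : GrushinPt n m | z.1 = 0} = 0 := by
  have := Fin.pos_iff_nonempty.1 hn
  have h : {z : GrushinPt n m | z.1 = 0} = {0} ×ˢ univ := by ext z; simp
  rw [h, Measure.volume_eq_prod, Measure.prod_prod]
  simp

namespace GrushinSetting

variable {n m : ℕ} {D : GrushinSetting n m}

theorem volume_ne_top (D : GrushinSetting n m) : volume D.Ω ≠ ⊤ := D.isBounded.measure_lt_top.ne

theorem Gminus_le (D : GrushinSetting n m) {z : GrushinPt n m} (hz : z ∈ D.Ω) :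
    D.Gminus ≤ D.G z :=
  csInf_le ⟨2, by rintro _ ⟨w, hw, rfl⟩; exact (D.two_lt_G w hw).le⟩ (mem_image_of_mem _ hz)

theorem C1c.eq_zero (u : D.C1c) {z : GrushinPt n m} (hz : z ∉ D.Ω) : u z = 0 :=
  image_eq_zero_of_notMem_tsupport fun h => hz (u.subset h)

theorem C1c.fderiv_eq_zero (u : D.C1c) {z : GrushinPt n m} (hz : z ∉ D.Ω) : fderiv ℝ u z = 0 :=
  fderiv_of_notMem_tsupport ℝ fun h => hz (u.subset h)

theorem C1c.norm_eq (u : D.C1c) : ‖u‖ = u.wNorm := rfl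

section Modular

variable {l : ℝ} (u : D.C1c)

theorem C1c.varModular_gradX_le (hu : ‖u‖ < l) :
    varModular D.μ D.G (fun z => ‖gradX u z‖ / l) ≤ 1 := by
  refine varModular_div_le_one_of_luxNorm_lt D.ae1 u.fin1 (lt_of_le_of_lt ?_ hu)
  rw [C1c.norm_eq, C1c.wNorm]
  nlinarith [@luxNorm_nonneg _ _ D.μ D.G (fun z => ‖z.1‖ ^ (D.γ / D.G z) * ‖gradY u z‖),
    @luxNorm_nonneg _ _ D.μ (fun z => D.G z + 1) (fun z => u z * D.A z ^ (1 / (D.G z + 1))),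
    @luxNorm_nonneg _ _ D.μ (fun z => D.G z - 1) (fun z => u z * D.A z ^ (1 / (D.G z - 1)))]

theorem C1c.varModular_gradY_le (hu : ‖u‖ < l) :
    varModular D.μ D.G (fun z => ‖z.1‖ ^ (D.γ / D.G z) * ‖gradY u z‖ / l) ≤ 1 := by
  refine varModular_div_le_one_of_luxNorm_lt D.ae1 u.fin2 (lt_of_le_of_lt ?_ hu)
  rw [C1c.norm_eq, C1c.wNorm]
  nlinarith [@luxNorm_nonneg _ _ D.μ D.G (fun z => ‖gradX u z‖),
    @luxNorm_nonneg _ _ D.μ (fun z => D.G z + 1) (fun z => u z * D.A z ^ (1 / (D.G z + 1))),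
    @luxNorm_nonneg _ _ D.μ (fun z => D.G z - 1) (fun z => u z * D.A z ^ (1 / (D.G z - 1)))]

theorem C1c.varModular_add_one_le (hu : ‖u‖ < l) : varModular D.μ (fun z => D.G z + 1)
    (fun z => u z * D.A z ^ (1 / (D.G z + 1)) / l) ≤ 1 := by
  refine varModular_div_le_one_of_luxNorm_lt D.ae3 u.fin3 (lt_of_le_of_lt ?_ hu)
  rw [C1c.norm_eq, C1c.wNorm]
  nlinarith [@luxNorm_nonneg _ _ D.μ D.G (fun z => ‖gradX u z‖),
    @luxNorm_nonneg _ _ D.μ D.G (fun z => ‖z.1‖ ^ (D.γ / D.G z) * ‖gradY u z‖),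
    @luxNorm_nonneg _ _ D.μ (fun z => D.G z - 1) (fun z => u z * D.A z ^ (1 / (D.G z - 1)))]

theorem C1c.varModular_sub_one_le (hu : ‖u‖ < l) : varModular D.μ (fun z => D.G z - 1)
    (fun z => u z * D.A z ^ (1 / (D.G z - 1)) / l) ≤ 1 := by
  refine varModular_div_le_one_of_luxNorm_lt D.ae4 u.fin4 (lt_of_le_of_lt ?_ hu)
  rw [C1c.norm_eq, C1c.wNorm]
  nlinarith [@luxNorm_nonneg _ _ D.μ D.G (fun z => ‖gradX u z‖),
    @luxNorm_nonneg _ _ D.μ D.G (fun z => ‖z.1‖ ^ (D.γ / D.G z) * ‖gradY u z‖),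
    @luxNorm_nonneg _ _ D.μ (fun z => D.G z + 1) (fun z => u z * D.A z ^ (1 / (D.G z + 1)))]

theorem ae_le_G (D : GrushinSetting n m) {q : ℝ} (hq : q ≤ D.Gminus) : ∀ᵐ z ∂D.μ, q ≤ D.G z :=
  (ae_restrict_mem D.isOpen.measurableSet).mono fun _ hz => hq.trans (D.Gminus_le hz)

end Modular

section UnitBall

variable {u : D.C1c}

theorem C1c.lintegral_gradX_le (hu : ‖u‖ < 1) {q : ℝ} (hq : 0 ≤ q) (hqG : q ≤ D.Gminus) :
    ∫⁻ z in D.Ω, ‖gradX u z‖ₑ ^ q ≤ volume D.Ω + 1 := by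
  have := lintegral_enorm_rpow_le_of_varModular hq (D.ae_le_G hqG) (u.varModular_gradX_le hu)
  simpa using this

theorem C1c.lintegral_gradY_le (hu : ‖u‖ < 1) {q : ℝ} (hq : 0 ≤ q) (hqG : q ≤ D.Gminus) :
    ∫⁻ z in D.Ω, ‖‖z.1‖ ^ (D.γ / D.G z) * ‖gradY u z‖‖ₑ ^ q ≤ volume D.Ω + 1 := by
  have := lintegral_enorm_rpow_le_of_varModular hq (D.ae_le_G hqG) (u.varModular_gradY_le hu)
  simpa using this

theorem C1c.lintegral_translateX_sub_le (hu : ‖u‖ < 1) {q : ℝ} (hq : 1 ≤ q)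
    (hqG : q ≤ D.Gminus) (a : EuclideanSpace ℝ (Fin n)) :
    ∫⁻ z, ‖u (z + (a, 0)) - u z‖ₑ ^ q ≤ ‖a‖ₑ ^ q * (volume D.Ω + 1) := by
  have hq0 : 0 < q := by linarith
  have h1 := setLIntegral_translate_sub_le (μ := volume) hq u.contDiff (S := univ)
    MeasurableSet.univ (v := (a, 0)) (by simp)
  rw [Measure.restrict_univ, lintegral_eq_setLIntegral (g := fun z => ‖fderiv ℝ u z (a, 0)‖ₑ ^ q)
    D.isOpen.measurableSet (fun z hz => by simp [u.fderiv_eq_zero hz, hq0])] at h1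
  refine h1.trans ?_
  calc _ ≤ ∫⁻ z in D.Ω, ‖a‖ₑ ^ q * ‖gradX u z‖ₑ ^ q := by
        refine lintegral_mono fun z => ?_
        rw [← ENNReal.mul_rpow_of_nonneg _ _ hq0.le]
        refine ENNReal.rpow_le_rpow ?_ hq0.le
        rw [← ofReal_norm, ← ofReal_norm, ← ofReal_norm,
          ← ENNReal.ofReal_mul (norm_nonneg _), norm_gradX (u.differentiable z), mul_comm]
        exact ENNReal.ofReal_le_ofReal (ContinuousLinearMap.le_opNorm
          ((fderiv ℝ u z).comp (ContinuousLinearMap.inl ℝ _ _)) a)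
    _ = ‖a‖ₑ ^ q * ∫⁻ z in D.Ω, ‖gradX u z‖ₑ ^ q :=
        lintegral_const_mul' _ _ (ENNReal.rpow_ne_top_of_nonneg hq0.le enorm_ne_top)
    _ ≤ _ := by gcongr; exact C1c.lintegral_gradX_le hu hq0.le hqG

theorem norm_fderiv_inr_le {ε : ℝ} (hε : 0 < ε) (hε1 : ε ≤ 1) {z : GrushinPt n m}
    (hz : z ∈ D.Ω) (hzε : ε ≤ ‖z.1‖) (k : EuclideanSpace ℝ (Fin m)) :
    ‖fderiv ℝ u z (0, k)‖ ≤
      ‖k‖ * (ε ^ D.γ)⁻¹ * ‖‖z.1‖ ^ (D.γ / D.G z) * ‖gradY u z‖‖ := by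
  have hG := D.two_lt_G z hz
  have h1 : ‖fderiv ℝ u z (0, k)‖ ≤ ‖gradY u z‖ * ‖k‖ := by
    rw [norm_gradY (u.differentiable z)]
    exact ContinuousLinearMap.le_opNorm
      ((fderiv ℝ u z).comp (ContinuousLinearMap.inr ℝ _ _)) k
  -- Since `G > 1` and `ε ≤ 1`, replacing the exponent `γ / G z` by `γ` only lowers the power of
  -- `ε`. The resulting bound does not depend on `z`.
  have h2 : ε ^ D.γ ≤ ‖z.1‖ ^ (D.γ / D.G z) := by
    refine (Real.rpow_le_rpow_of_exponent_ge hε hε1 ?_).trans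
      (Real.rpow_le_rpow hε.le hzε (div_pos D.γ_pos (by linarith)).le)
    exact div_le_self D.γ_pos.le (by linarith)
  have h3 : 0 < ε ^ D.γ := Real.rpow_pos_of_pos hε _
  rw [norm_mul, norm_norm, Real.norm_of_nonneg (h3.le.trans h2)]
  calc _ ≤ _ := h1
    _ = ‖k‖ * (ε ^ D.γ)⁻¹ * (ε ^ D.γ * ‖gradY u z‖) := by field_simp
    _ ≤ _ := by gcongr

theorem C1c.setLIntegral_translateY_sub_le (hu : ‖u‖ < 1) {q : ℝ} (hq : 1 ≤ q)
    (hqG : q ≤ D.Gminus) {ε : ℝ} (hε : 0 < ε) (hε1 : ε ≤ 1) (k : EuclideanSpace ℝ (Fin m)) :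
    ∫⁻ z in {z | ε ≤ ‖z.1‖}, ‖u (z + (0, k)) - u z‖ₑ ^ q ≤
      ‖k‖ₑ ^ q * (‖(ε ^ D.γ)⁻¹‖ₑ ^ q * (volume D.Ω + 1)) := by
  have hq0 : 0 < q := by linarith
  have hSm : MeasurableSet {z : GrushinPt n m | ε ≤ ‖z.1‖} :=
    (isClosed_le continuous_const (by fun_prop)).measurableSet
  refine (setLIntegral_translate_sub_le (μ := volume) hq u.contDiff hSm (v := (0, k))
    (by simp)).trans ?_
  calc _ ≤ ∫⁻ z in {z | ε ≤ ‖z.1‖}, D.Ω.indicator (fun z => ‖k‖ₑ ^ q * ‖(ε ^ D.γ)⁻¹‖ₑ ^ q *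
          ‖‖z.1‖ ^ (D.γ / D.G z) * ‖gradY u z‖‖ₑ ^ q) z := by
        refine setLIntegral_mono' hSm fun z hz => ?_
        by_cases hzΩ : z ∈ D.Ω
        · rw [indicator_of_mem hzΩ, ← ENNReal.mul_rpow_of_nonneg _ _ hq0.le,
            ← ENNReal.mul_rpow_of_nonneg _ _ hq0.le]
          refine ENNReal.rpow_le_rpow ?_ hq0.le
          rw [← enorm_norm k, ← enorm_mul, ← enorm_mul, enorm_le_iff_norm_le]
          refine (norm_fderiv_inr_le hε hε1 hzΩ hz k).trans_eq ?_
          simp only [norm_mul, norm_norm, norm_inv]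
          rw [Real.norm_of_nonneg (Real.rpow_nonneg hε.le _)]
        · simp [u.fderiv_eq_zero hzΩ, hq0]
    _ ≤ ∫⁻ z, D.Ω.indicator (fun z => ‖k‖ₑ ^ q * ‖(ε ^ D.γ)⁻¹‖ₑ ^ q *
          ‖‖z.1‖ ^ (D.γ / D.G z) * ‖gradY u z‖‖ₑ ^ q) z := setLIntegral_le_lintegral _ _
    _ = ‖k‖ₑ ^ q * ‖(ε ^ D.γ)⁻¹‖ₑ ^ q *
          ∫⁻ z in D.Ω, ‖‖z.1‖ ^ (D.γ / D.G z) * ‖gradY u z‖‖ₑ ^ q := by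
        rw [lintegral_indicator D.isOpen.measurableSet, lintegral_const_mul']
        exact ENNReal.mul_ne_top (ENNReal.rpow_ne_top_of_nonneg hq0.le enorm_ne_top)
          (ENNReal.rpow_ne_top_of_nonneg hq0.le enorm_ne_top)
    _ ≤ _ := by
        rw [mul_assoc]
        gcongr
        exact C1c.lintegral_gradY_le hu hq0.le hqG

/-- Poincaré's inequality. -/
theorem exists_lintegral_rpow_le (hn : 0 < n) (D : GrushinSetting n m) {q : ℝ} (hq : 1 ≤ q)
    (hqG : q ≤ D.Gminus) :
    ∃ C : ℝ≥0∞, C ≠ ⊤ ∧ ∀ u : D.C1c, ‖u‖ < 1 → ∫⁻ z, ‖u z‖ₑ ^ q ≤ C := by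
  have hq0 : 0 < q := by linarith
  obtain ⟨R, hR⟩ := D.isBounded.exists_norm_le
  -- The length exceeds twice the norm of any point of `Ω`, so translation by `(a, 0)` moves `Ω` off
  -- itself and `u (z + (a, 0)) = 0` for `z ∈ Ω`. The increment is then `-u z`.
  set a : EuclideanSpace ℝ (Fin n) := EuclideanSpace.single ⟨0, hn⟩ (2 * |R| + 1) with ha
  have hna : ‖a‖ = 2 * |R| + 1 := by
    rw [ha, PiLp.norm_single, Real.norm_of_nonneg (by positivity)]
  refine ⟨‖a‖ₑ ^ q * (volume D.Ω + 1), ENNReal.mul_ne_top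
    (ENNReal.rpow_ne_top_of_nonneg hq0.le enorm_ne_top)
    (ENNReal.add_ne_top.2 ⟨D.volume_ne_top, by simp⟩), fun u hu => ?_⟩
  rw [lintegral_eq_setLIntegral D.isOpen.measurableSet
    (fun z hz => by simp [u.eq_zero hz, hq0])]
  refine le_trans ?_ (C1c.lintegral_translateX_sub_le hu hq hqG a)
  refine le_trans ?_ (setLIntegral_le_lintegral D.Ω _)
  refine setLIntegral_mono' D.isOpen.measurableSet fun z hz => ?_
  rw [u.eq_zero (z := z + (a, 0)), zero_sub, enorm_neg]
  intro h
  have h1 := norm_fst_le z |>.trans (hR z hz)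
  have h2 := norm_fst_le (z + (a, 0)) |>.trans (hR _ h)
  have h3 : ‖a‖ ≤ ‖z.1 + a‖ + ‖z.1‖ := by
    simpa using norm_sub_le (z.1 + a) z.1
  have h4 : ‖z.1 + a‖ ≤ R := by simpa using h2
  linarith [le_abs_self R, abs_nonneg R]

/-- The strips decrease to `Ω ∩ {x = 0}`, which is null because `n > 0`. -/
theorem tendsto_volume_strip (hn : 0 < n) (D : GrushinSetting n m) :
    Tendsto (fun j : ℕ => volume (D.Ω ∩ {z | ‖z.1‖ < 1 / ((j : ℝ) + 1)})) atTop (𝓝 0) := by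
  have hm : ∀ j : ℕ, MeasurableSet (D.Ω ∩ {z | ‖z.1‖ < 1 / ((j : ℝ) + 1)}) := fun j =>
    D.isOpen.measurableSet.inter (isOpen_lt (by fun_prop) continuous_const).measurableSet
  have h := tendsto_measure_iInter_atTop (μ := volume) (fun j => (hm j).nullMeasurableSet)
    (fun i j hij z hz => ⟨hz.1, lt_of_lt_of_le (mem_ofPred.1 hz.2)
      (one_div_le_one_div_of_le (by positivity) (by gcongr))⟩)
    ⟨0, measure_ne_top_of_subset inter_subset_left D.volume_ne_top⟩
  rwa [measure_mono_null (fun z hz => ?_) (GrushinPt.volume_fst_eq_zero hn)] at h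
  have h1 : ∀ j : ℕ, ‖z.1‖ ≤ 1 / ((j : ℝ) + 1) := fun j => (mem_iInter.1 hz j).2.le
  have h2 : ‖z.1‖ ≤ 0 := ge_of_tendsto' tendsto_one_div_add_atTop_nhds_zero_nat h1
  exact norm_le_zero_iff.1 h2

/-- Hölder bounds the strip integral by `C ^ (s / G⁻)` times the strip's measure to the power `1 - s
/ G⁻`. This power is positive exactly because `s < G⁻`. -/
theorem exists_strip (hn : 0 < n) (D : GrushinSetting n m) {s : ℝ} (hs : 1 < s)
    (hsG : s < D.Gminus) {e : ℝ≥0∞} (he : 0 < e) :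
    ∃ ε : ℝ, 0 < ε ∧ ε ≤ 1 ∧ ∀ u : D.C1c, ‖u‖ < 1 →
      ∫⁻ z in {z | ε ≤ ‖z.1‖}ᶜ, ‖u z‖ₑ ^ s ≤ e := by
  have hs0 : 0 < s := by linarith
  obtain ⟨C, hC, hCu⟩ := exists_lintegral_rpow_le hn D (hs.trans hsG).le le_rfl
  have hr : 0 < D.Gminus := hs0.trans hsG
  have hsr : s / D.Gminus < 1 := (div_lt_one (by linarith)).2 hsG
  have hlim := ENNReal.Tendsto.const_mul (a := C ^ (s / D.Gminus))
    ((ENNReal.continuous_rpow_const (y := 1 - s / D.Gminus)).tendsto 0 |>.comp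
      (tendsto_volume_strip hn D))
    (Or.inr (ENNReal.rpow_ne_top_of_nonneg (by positivity) hC))
  rw [ENNReal.zero_rpow_of_pos (by linarith), mul_zero] at hlim
  obtain ⟨j, hj⟩ := (hlim.eventually_le_const he).exists
  refine ⟨1 / ((j : ℝ) + 1), by positivity, ?_, fun u hu => le_trans ?_ hj⟩
  · rw [div_le_one (by positivity)]; linarith [j.cast_nonneg (α := ℝ)]
  have hS : {z : GrushinPt n m | 1 / ((j : ℝ) + 1) ≤ ‖z.1‖}ᶜ = {z | ‖z.1‖ < 1 / ((j : ℝ) + 1)} := by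
    ext z; simp
  rw [hS, lintegral_eq_setLIntegral D.isOpen.measurableSet
    (fun z hz => by simp [u.eq_zero hz, hs0]), Measure.restrict_restrict D.isOpen.measurableSet]
  refine (lintegral_enorm_rpow_le_mul_measure hs0 hsG.le
    u.contDiff.continuous.aestronglyMeasurable).trans ?_
  rw [Measure.restrict_apply_univ]
  simp only [Function.comp_apply]
  gcongr ?_ * _
  exact ENNReal.rpow_le_rpow ((setLIntegral_le_lintegral _ _).trans (hCu u hu)) (by positivity)

/-- Fix the strip first, so that the loss `ε^{-γ}` away from it is a constant, then shrink `δ`.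
Inside the strip no smallness of `k` is needed: `u` and its translate have the same small mass
there. -/
theorem exists_translateY_sub_le (hn : 0 < n) (D : GrushinSetting n m) {s : ℝ} (hs : 1 < s)
    (hsG : s < D.Gminus) {e : ℝ≥0∞} (he : 0 < e) :
    ∃ δ : ℝ, 0 < δ ∧ ∀ u : D.C1c, ‖u‖ < 1 → ∀ k : EuclideanSpace ℝ (Fin m), ‖k‖ < δ →
      ∫⁻ z, ‖u (z + (0, k)) - u z‖ₑ ^ s ≤ e := by
  have hs0 : 0 < s := by linarith
  have h3 : (3 : ℝ≥0∞) ^ s ≠ ⊤ := ENNReal.rpow_ne_top_of_nonneg hs0.le (by simp)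
  have he2 : 0 < e / 2 := ENNReal.half_pos he.ne'
  obtain ⟨e1, he1, he1t, hee1⟩ := ENNReal.exists_pos_mul_le (a := 3 ^ s * 2)
    (ENNReal.mul_ne_top h3 (by simp)) he2
  obtain ⟨ε, hε, hε1, hεu⟩ := exists_strip hn D hs hsG he1
  obtain ⟨δ, hδ, hδe⟩ := ENNReal.exists_pos_ofReal_rpow_le
    (a := ‖(ε ^ D.γ)⁻¹‖ₑ ^ s * (volume D.Ω + 1))
    (ENNReal.mul_ne_top (ENNReal.rpow_ne_top_of_nonneg hs0.le enorm_ne_top)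
      (ENNReal.add_ne_top.2 ⟨D.volume_ne_top, by simp⟩)) he2 hs0
  refine ⟨δ, hδ, fun u hu k hk => ?_⟩
  have hSm : MeasurableSet {z : GrushinPt n m | ε ≤ ‖z.1‖} :=
    (isClosed_le continuous_const (by fun_prop)).measurableSet
  rw [← lintegral_add_compl _ hSm, ← ENNReal.add_halves e]
  gcongr
  · refine (C1c.setLIntegral_translateY_sub_le hu hs.le hsG.le hε hε1 k).trans ?_
    rw [mul_comm]
    refine le_trans ?_ hδe
    gcongr
    rw [← ofReal_norm]
    exact ENNReal.ofReal_le_ofReal hk.le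
  · calc _ ≤ ∫⁻ z in {z | ε ≤ ‖z.1‖}ᶜ, 3 ^ s * (‖u (z + (0, k))‖ₑ ^ s + ‖u z‖ₑ ^ s) := by
          refine lintegral_mono fun z => ?_
          have := enorm_sub_rpow_le hs0.le (u (z + (0, k))) 0 0 (u z)
          simpa [hs0] using this
      _ = 3 ^ s * ((∫⁻ z in {z | ε ≤ ‖z.1‖}ᶜ, ‖u (z + (0, k))‖ₑ ^ s) +
            ∫⁻ z in {z | ε ≤ ‖z.1‖}ᶜ, ‖u z‖ₑ ^ s) := by
          rw [lintegral_const_mul' _ _ h3, lintegral_add_right]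
          exact u.contDiff.continuous.measurable.enorm.pow_const s
      _ = 3 ^ s * ((∫⁻ z in {z | ε ≤ ‖z.1‖}ᶜ, ‖u z‖ₑ ^ s) +
            ∫⁻ z in {z | ε ≤ ‖z.1‖}ᶜ, ‖u z‖ₑ ^ s) := by
          rw [setLIntegral_translate hSm.compl (v := (0, k)) (by simp) fun z => ‖u z‖ₑ ^ s]
      _ ≤ 3 ^ s * (e1 + e1) := by gcongr <;> exact hεu u hu
      _ = 3 ^ s * 2 * e1 := by ring
      _ ≤ e / 2 := hee1

theorem exists_translate_sub_le (hn : 0 < n) (D : GrushinSetting n m) {s : ℝ} (hs : 1 < s)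
    (hsG : s < D.Gminus) {e : ℝ≥0∞} (he : 0 < e) :
    ∃ δ : ℝ, 0 < δ ∧ ∀ u : D.C1c, ‖u‖ < 1 → ∀ h : GrushinPt n m, ‖h‖ < δ →
      ∫⁻ z, ‖u (z + h) - u z‖ₑ ^ s ≤ e := by
  have hs0 : 0 < s := by linarith
  have h3 : (3 : ℝ≥0∞) ^ s ≠ ⊤ := ENNReal.rpow_ne_top_of_nonneg hs0.le (by simp)
  obtain ⟨e1, he1, he1t, hee1⟩ := ENNReal.exists_pos_mul_le (a := 3 ^ s * 2)
    (ENNReal.mul_ne_top h3 (by simp)) he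
  obtain ⟨δ, hδ, hδu⟩ := exists_translateY_sub_le hn D hs hsG he1
  obtain ⟨δ', hδ', hδe⟩ := ENNReal.exists_pos_ofReal_rpow_le
    (a := volume D.Ω + 1) (ENNReal.add_ne_top.2 ⟨D.volume_ne_top, by simp⟩) he1 hs0
  refine ⟨min δ δ', lt_min hδ hδ', fun u hu h hh => ?_⟩
  -- The increment is split through `z + (0, h.2)`; invariance of Lebesgue measure moves the base
  -- point of the `x`-estimate there.
  have hX : ∫⁻ z, ‖u (z + h) - u (z + (0, h.2))‖ₑ ^ s ≤ e1 := by
    have h1 := C1c.lintegral_translateX_sub_le hu hs.le hsG.le h.1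
    rw [← lintegral_add_right_eq_self _ ((0, h.2) : GrushinPt n m)] at h1
    have h2 : ∀ z : GrushinPt n m, z + (0, h.2) + (h.1, 0) = z + h := by
      intro z; ext <;> simp
    simp only [h2] at h1
    refine h1.trans (le_trans ?_ hδe)
    rw [mul_comm]
    gcongr
    rw [← ofReal_norm]
    exact ENNReal.ofReal_le_ofReal
      ((norm_fst_le h).trans (hh.le.trans (min_le_right _ _)))
  have hY := hδu u hu h.2 ((norm_snd_le h).trans_lt (hh.trans_le (min_le_left _ _)))
  have hc := u.contDiff.continuous
  calc _ ≤ ∫⁻ z, 3 ^ s * (‖u (z + h) - u (z + (0, h.2))‖ₑ ^ s +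
          ‖u (z + (0, h.2)) - u z‖ₑ ^ s) := by
        refine lintegral_mono fun z => ?_
        have := enorm_sub_rpow_le hs0.le (u (z + h)) (u (z + (0, h.2))) (u z) (u z)
        simpa [hs0] using this
    _ = 3 ^ s * ((∫⁻ z, ‖u (z + h) - u (z + (0, h.2))‖ₑ ^ s) +
          ∫⁻ z, ‖u (z + (0, h.2)) - u z‖ₑ ^ s) := by
        rw [lintegral_const_mul' _ _ h3, lintegral_add_right]
        have : Continuous fun z => u (z + (0, h.2)) - u z := by fun_prop
        exact this.measurable.enorm.pow_const s
    _ ≤ 3 ^ s * (e1 + e1) := by gcongr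
    _ = 3 ^ s * 2 * e1 := by ring
    _ ≤ e := hee1

end UnitBall

end GrushinSetting

/-! ### Closability of the norm -/

theorem exists_seq_tendsto_zero_of_eLpNorm {α F : Type*} [MeasurableSpace α] {ν : Measure α}
    [NormedAddCommGroup F] {f : ℕ → α → F} (hf : ∀ k, AEStronglyMeasurable (f k) ν)
    (h : Tendsto (fun k => eLpNorm (f k) 1 ν) atTop (𝓝 0)) :
    ∃ ns : ℕ → ℕ, StrictMono ns ∧ ∀ᵐ z ∂ν, Tendsto (fun i => f (ns i) z) atTop (𝓝 0) := by
  have := tendstoInMeasure_of_tendsto_eLpNorm (g := fun _ => (0 : F)) one_ne_zero hf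
    aestronglyMeasurable_const (by
      have e : ∀ k, (f k - fun _ => (0 : F)) = f k := fun k => by ext; simp
      simpa only [e] using h)
  exact this.exists_seq_tendsto_ae

theorem exists_tendsto_eLpNorm_of_cauchy {α F : Type*} [MeasurableSpace α] {ν : Measure α}
    [NormedAddCommGroup F] [CompleteSpace F] {f : ℕ → α → F} (hf : ∀ k, MemLp (f k) 1 ν)
    (h : ∀ e : ℝ≥0∞, 0 < e → ∃ N, ∀ j ≥ N, ∀ k ≥ N, eLpNorm (f j - f k) 1 ν < e) :
    ∃ g : α → F, MemLp g 1 ν ∧ Tendsto (fun k => eLpNorm (f k - g) 1 ν) atTop (𝓝 0) := by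
  have hc : CauchySeq fun k => (hf k).toLp := by
    rw [EMetric.cauchySeq_iff]
    intro e he
    obtain ⟨N, hN⟩ := h e he
    refine ⟨N, fun j hj k hk => ?_⟩
    rw [Lp.edist_toLp_toLp]
    exact hN j hj k hk
  obtain ⟨g, hg⟩ := cauchySeq_tendsto_of_complete hc
  refine ⟨g, Lp.memLp g, ?_⟩
  exact (Lp.tendsto_Lp_iff_tendsto_eLpNorm'' f hf g (Lp.memLp g)).1 (by simpa using hg)

section Closable

variable {E : Type*} [NormedAddCommGroup E] [NormedSpace ℝ E] [FiniteDimensional ℝ E]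
  [MeasurableSpace E] [BorelSpace E] {μ : Measure E} [μ.IsAddHaarMeasure]
  {F : Type*} [NormedAddCommGroup F] [NormedSpace ℝ F]

/-- Integration by parts puts the derivative on `φ`, whose derivative is bounded, so `L¹`
convergence of `u` suffices. -/
theorem tendsto_integral_smul_fderiv_zero {u : ℕ → E → ℝ} (hu : ∀ k, ContDiff ℝ 1 (u k))
    (hlim : Tendsto (fun k => eLpNorm (u k) 1 μ) atTop (𝓝 0))
    {φ : E → ℝ} (hφ : ContDiff ℝ ∞ φ) (hφc : HasCompactSupport φ) (v : E) :
    Tendsto (fun k => ∫ z, φ z * fderiv ℝ (u k) z v ∂μ) atTop (𝓝 0) := by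
  have hφ1 : ContDiff ℝ 1 φ := hφ.of_le (by exact_mod_cast le_top)
  have hdφ : Continuous fun z => fderiv ℝ φ z v :=
    (hφ1.continuous_fderiv one_ne_zero).clm_apply continuous_const
  have hdφc : HasCompactSupport fun z => fderiv ℝ φ z v := hφc.fderiv_apply ℝ v
  have hdu : ∀ k, Continuous fun z => fderiv ℝ (u k) z v := fun k =>
    ((hu k).continuous_fderiv one_ne_zero).clm_apply continuous_const
  have hint : ∀ k, Integrable (fun z => fderiv ℝ φ z v * u k z) μ := fun k =>
    (hdφ.mul (hu k).continuous).integrable_of_hasCompactSupport hdφc.mul_right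
  have hparts : ∀ k, ∫ z, φ z * fderiv ℝ (u k) z v ∂μ = -∫ z, fderiv ℝ φ z v * u k z ∂μ :=
    fun k => integral_mul_fderiv_eq_neg_fderiv_mul_of_integrable (hint k)
      ((hφ1.continuous.mul (hdu k)).integrable_of_hasCompactSupport hφc.mul_right)
      ((hφ1.continuous.mul (hu k).continuous).integrable_of_hasCompactSupport hφc.mul_right)
      (fun z _ => hφ1.differentiable one_ne_zero z)
      (fun z _ => (hu k).differentiable one_ne_zero z)
  simp only [hparts]
  obtain ⟨M, hM⟩ := hdφ.bounded_above_of_compact_support hdφc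
  have h1 : Tendsto (fun k => ∫ z, fderiv ℝ φ z v * u k z ∂μ) atTop (𝓝 (∫ _, (0 : ℝ) ∂μ)) := by
    refine tendsto_integral_of_L1' _ aestronglyMeasurable_const (Eventually.of_forall hint) ?_
    have h2 : Tendsto (fun k => ENNReal.ofReal M * eLpNorm (u k) 1 μ) atTop (𝓝 0) := by
      simpa using ENNReal.Tendsto.const_mul hlim (Or.inr ENNReal.ofReal_ne_top)
    refine tendsto_of_tendsto_of_tendsto_of_le_of_le tendsto_const_nhds h2
      (fun _ => zero_le) fun k => ?_
    refine eLpNorm_le_mul_eLpNorm_of_ae_le_mul (Eventually.of_forall fun z => ?_) 1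
    simp only [Pi.sub_apply, sub_zero, norm_mul]
    gcongr
    exact hM z
  simpa using h1.neg

/-- A weighted partial derivative is a closable operator in `L¹`. -/
theorem tendsto_eLpNorm_weighted_fderiv_zero {U : Set E} (hU : IsOpen U) {w : E → ℝ}
    (hw : ContinuousOn w U) (hw0 : ∀ z ∈ U, 0 < w z) (J : F →L[ℝ] E) {u : ℕ → E → ℝ}
    (hu : ∀ k, ContDiff ℝ 1 (u k))
    (hmem : ∀ k, MemLp (fun z => w z • (fderiv ℝ (u k) z).comp J) 1 (μ.restrict U))
    (hcau : ∀ e : ℝ≥0∞, 0 < e → ∃ N, ∀ j ≥ N, ∀ k ≥ N,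
      eLpNorm ((fun z => w z • (fderiv ℝ (u j) z).comp J) -
        fun z => w z • (fderiv ℝ (u k) z).comp J) 1 (μ.restrict U) < e)
    (hlim : Tendsto (fun k => eLpNorm (u k) 1 μ) atTop (𝓝 0)) :
    Tendsto (fun k => eLpNorm (fun z => w z • (fderiv ℝ (u k) z).comp J) 1 (μ.restrict U))
      atTop (𝓝 0) := by
  obtain ⟨g, hg, hfg⟩ := exists_tendsto_eLpNorm_of_cauchy hmem hcau
  have hwi : ContinuousOn (fun z => (w z)⁻¹) U := hw.inv₀ fun z hz => (hw0 z hz).ne'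
  have hgi : Integrable g (μ.restrict U) := memLp_one_iff_integrable.1 hg
  have hloc : LocallyIntegrableOn (fun z => (w z)⁻¹ • g z) U μ :=
    LocallyIntegrableOn.continuousOn_smul hU.isLocallyClosed
      (IntegrableOn.locallyIntegrableOn hgi) hwi
  have hzero : ∀ᵐ z ∂μ, z ∈ U → (w z)⁻¹ • g z = 0 := by
    refine hU.ae_eq_zero_of_integral_contDiff_smul_eq_zero hloc fun φ hφ hφc hφU => ?_
    -- The weight may degenerate at the edge of `U`, but `φ / w` stays bounded because the support
    -- of `φ` is compact in `U`. Pairing with it is therefore continuous for `L¹` convergence.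
    have hψc : ContinuousOn (fun z => φ z * (w z)⁻¹) U := hφ.continuous.continuousOn.mul hwi
    have hψm : AEStronglyMeasurable (fun z => φ z * (w z)⁻¹) (μ.restrict U) :=
      hψc.aestronglyMeasurable hU.measurableSet
    obtain ⟨M, hM⟩ := hφc.isCompact.exists_bound_of_continuousOn (hψc.mono hφU)
    have hMz : ∀ z, ‖φ z * (w z)⁻¹‖ ≤ |M| := by
      intro z
      by_cases hz : z ∈ tsupport φ
      · exact (hM z hz).trans (le_abs_self M)
      · simp [image_eq_zero_of_notMem_tsupport hz]
    have hφ0 : ∀ z ∉ U, φ z = 0 := fun z hz =>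
      image_eq_zero_of_notMem_tsupport fun h => hz (hφU h)
    have hmi : ∀ k, Integrable
        (fun z => (φ z * (w z)⁻¹) • w z • (fderiv ℝ (u k) z).comp J) (μ.restrict U) := fun k =>
      (memLp_one_iff_integrable.1 (hmem k)).bdd_smul |M| hψm (Eventually.of_forall hMz)
    have hgψ : Integrable (fun z => (φ z * (w z)⁻¹) • g z) (μ.restrict U) :=
      hgi.bdd_smul |M| hψm (Eventually.of_forall hMz)
    have hT : Tendsto (fun k => ∫ z in U, (φ z * (w z)⁻¹) • w z • (fderiv ℝ (u k) z).comp J ∂μ)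
        atTop (𝓝 (∫ z in U, (φ z * (w z)⁻¹) • g z ∂μ)) := by
      refine tendsto_integral_of_L1' _ hgψ.aestronglyMeasurable (Eventually.of_forall hmi) ?_
      have h2 : Tendsto (fun k => ENNReal.ofReal |M| *
          eLpNorm ((fun z => w z • (fderiv ℝ (u k) z).comp J) - g) 1 (μ.restrict U))
          atTop (𝓝 0) := by
        simpa using ENNReal.Tendsto.const_mul hfg (Or.inr ENNReal.ofReal_ne_top)
      refine tendsto_of_tendsto_of_tendsto_of_le_of_le tendsto_const_nhds h2
        (fun _ => zero_le) fun k => ?_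
      refine eLpNorm_le_mul_eLpNorm_of_ae_le_mul (Eventually.of_forall fun z => ?_) 1
      simp only [Pi.sub_apply]
      rw [← smul_sub, norm_smul]
      gcongr
      exact hMz z
    have hgoal : ∫ z, φ z • (w z)⁻¹ • g z ∂μ = ∫ z in U, (φ z * (w z)⁻¹) • g z ∂μ := by
      rw [setIntegral_eq_integral_of_forall_compl_eq_zero fun z hz => by simp [hφ0 z hz]]
      simp only [mul_smul]
    rw [hgoal]
    ext v
    rw [zero_apply]
    have h1 : Tendsto (fun k => (∫ z in U, (φ z * (w z)⁻¹) • w z •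
        (fderiv ℝ (u k) z).comp J ∂μ) v) atTop
        (𝓝 ((∫ z in U, (φ z * (w z)⁻¹) • g z ∂μ) v)) :=
      ((ContinuousLinearMap.apply ℝ ℝ v).continuous.tendsto _).comp hT
    -- The factor `1 / w` cancels the weight, leaving the pairing of `φ` with the derivative of `u
    -- k` along `J v`, which tends to zero.
    refine tendsto_nhds_unique h1 ?_
    refine (tendsto_integral_smul_fderiv_zero hu hlim hφ hφc (J v)).congr fun k => ?_
    rw [ContinuousLinearMap.integral_apply (hmi k),
      ← setIntegral_eq_integral_of_forall_compl_eq_zero (s := U) fun z hz => by simp [hφ0 z hz]]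
    refine setIntegral_congr_fun hU.measurableSet fun z hz => ?_
    have := (hw0 z hz).ne'
    simp only [smul_apply, ContinuousLinearMap.comp_apply, smul_eq_mul]
    field_simp
  have hg0 : g =ᵐ[μ.restrict U] 0 := by
    rw [EventuallyEq, ae_restrict_iff' hU.measurableSet]
    filter_upwards [hzero] with z hz hzU
    have := hz hzU
    rwa [smul_eq_zero_iff_right (inv_ne_zero (hw0 z hzU).ne')] at this
  refine hfg.congr fun k => eLpNorm_congr_ae ?_
  filter_upwards [hg0] with z hz
  simp [hz]

end Closable

theorem lintegral_enorm_le_of_varModular {α : Type*} [MeasurableSpace α] {μ : Measure α}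
    {p f : α → ℝ} {l : ℝ} (hl : 0 < l) (hp : ∀ᵐ z ∂μ, 1 ≤ p z)
    (h : varModular μ p (fun z => f z / l) ≤ 1) :
    ∫⁻ z, ‖f z‖ₑ ∂μ ≤ ENNReal.ofReal l * (μ univ + 1) := by
  have h1 := lintegral_enorm_rpow_le_of_varModular zero_le_one hp h
  simp only [ENNReal.rpow_one] at h1
  refine le_trans (le_of_eq ?_) (mul_le_mul_right h1 _)
  rw [← lintegral_const_mul' _ _ ENNReal.ofReal_ne_top]
  refine lintegral_congr fun z => ?_
  rw [← Real.enorm_of_nonneg hl.le, ← enorm_mul, mul_div_cancel₀ _ hl.ne']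

namespace GrushinSetting

variable {n m : ℕ} {D : GrushinSetting n m} {u : ℕ → D.C1c}

theorem exists_norm_sub_lt (hu : CauchySeq u) {l : ℝ} (hl : 0 < l) :
    ∃ N, ∀ j ≥ N, ∀ k ≥ N, ‖u j - u k‖ < l := by
  obtain ⟨N, hN⟩ := Metric.cauchySeq_iff.1 hu l hl
  exact ⟨N, fun j hj k hk => by rw [← dist_eq_norm]; exact hN j hj k hk⟩

/-- Along a subsequence `u k - u j → u k` almost everywhere, while the modular at scale `l` is at
most 1 by the Cauchy property; Fatou transfers this bound to `u k`. -/
theorem eventually_luxNorm_mul_le (hu : CauchySeq u)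
    (hlim : Tendsto (fun k => eLpNorm (u k) 1 volume) atTop (𝓝 0)) {p a : GrushinPt n m → ℝ}
    (hp : ∀ᵐ z ∂D.μ, 1 ≤ p z) (hpm : AEMeasurable p D.μ)
    (ham : ∀ u : D.C1c, AEMeasurable (fun z => u z * a z) D.μ)
    (hmod : ∀ (u : D.C1c) (l : ℝ), ‖u‖ < l → varModular D.μ p (fun z => u z * a z / l) ≤ 1)
    {l : ℝ} (hl : 0 < l) : ∀ᶠ k in atTop, luxNorm D.μ p (fun z => u k z * a z) ≤ l := by
  obtain ⟨ns, hns, hae⟩ := exists_seq_tendsto_zero_of_eLpNorm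
    (fun k => (u k).contDiff.continuous.aestronglyMeasurable) hlim
  obtain ⟨N, hN⟩ := exists_norm_sub_lt hu hl
  filter_upwards [eventually_ge_atTop N] with k hk
  refine luxNorm_le_of_varModular hl (varModular_le_of_tendsto
    -- As `ns i ≥ i`, the shift by `N` keeps the second index in the Cauchy range.
    (F := fun i z => (u k - u (ns (i + N))) z * a z / l) hp hpm
    (fun i => (ham _).div_const l) (fun i => hmod _ l (hN k hk _ ?_)) ?_)
  · exact le_trans (Nat.le_add_left N i) (hns.id_le _)
  · filter_upwards [ae_restrict_of_ae hae] with z hz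
    have h1 := ((((tendsto_add_atTop_iff_nat N).2 hz).const_sub (u k z)).mul_const (a z)).div_const l
    rw [sub_zero] at h1
    exact h1

/-- The same Fatou argument for gradients, where almost everywhere convergence comes from
closability on `U`, the part of full measure where the weight is positive. -/
theorem eventually_luxNorm_fderiv_le (hu : CauchySeq u)
    (hlim : Tendsto (fun k => eLpNorm (u k) 1 volume) atTop (𝓝 0))
    {F : Type*} [NormedAddCommGroup F] [NormedSpace ℝ F] (J : F →L[ℝ] GrushinPt n m)
    {w : GrushinPt n m → ℝ} (hw : ContinuousOn w D.Ω) {U : Set (GrushinPt n m)} (hU : IsOpen U)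
    (hUΩ : U =ᵐ[volume] D.Ω) (hUs : U ⊆ D.Ω) (hw0 : ∀ z ∈ U, 0 < w z)
    (hmod : ∀ (u : D.C1c) (l : ℝ), ‖u‖ < l →
      varModular D.μ D.G (fun z => w z * ‖(fderiv ℝ u z).comp J‖ / l) ≤ 1)
    {l : ℝ} (hl : 0 < l) :
    ∀ᶠ k in atTop, luxNorm D.μ D.G (fun z => w z * ‖(fderiv ℝ (u k) z).comp J‖) ≤ l := by
  have hres : volume.restrict U = D.μ := Measure.restrict_congr_set hUΩ
  have hcont : ∀ u : D.C1c, ContinuousOn (fun z => w z • (fderiv ℝ u z).comp J) D.Ω := fun u =>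
    hw.smul ((u.contDiff.continuous_fderiv one_ne_zero).clm_comp continuous_const).continuousOn
  have hcontn : ∀ u : D.C1c, ContinuousOn (fun z => w z * ‖(fderiv ℝ u z).comp J‖) D.Ω := fun u =>
    hw.mul ((u.contDiff.continuous_fderiv one_ne_zero).clm_comp
      continuous_const).norm.continuousOn
  have hsm : ∀ u : D.C1c, AEStronglyMeasurable (fun z => w z • (fderiv ℝ u z).comp J) D.μ :=
    fun u => (hcont u).aestronglyMeasurable D.isOpen.measurableSet
  have hL1 : ∀ (u : D.C1c) (l : ℝ), 0 < l → ‖u‖ < l →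
      eLpNorm (fun z => w z • (fderiv ℝ u z).comp J) 1 D.μ ≤
        ENNReal.ofReal l * (volume D.Ω + 1) := by
    intro u l hl hul
    have h1 := lintegral_enorm_le_of_varModular hl D.ae1 (hmod u l hul)
    rw [Measure.restrict_apply_univ] at h1
    rw [eLpNorm_one_eq_lintegral_enorm]
    refine le_trans (le_of_eq ?_) h1
    refine lintegral_congr fun z => ?_
    rw [enorm_smul, enorm_mul, enorm_norm]
  have hV : volume D.Ω + 1 ≠ ⊤ := ENNReal.add_ne_top.2 ⟨D.volume_ne_top, by simp⟩
  have hsub : ∀ (a b : D.C1c) z, w z • (fderiv ℝ (a - b : D.C1c) z).comp J =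
      w z • (fderiv ℝ a z).comp J - w z • (fderiv ℝ b z).comp J := by
    intro a b z
    have h1 : fderiv ℝ (a - b : D.C1c) z = fderiv ℝ a z - fderiv ℝ b z :=
      fderiv_sub (a.differentiable z) (b.differentiable z)
    rw [h1, ContinuousLinearMap.sub_comp, smul_sub]
  have htend := tendsto_eLpNorm_weighted_fderiv_zero (μ := volume) hU (hw.mono hUs) hw0 J
    (fun k => (u k).contDiff) (fun k => by
      rw [hres]
      exact ⟨hsm _, (hL1 (u k) (‖u k‖ + 1) (by positivity) (by linarith)).trans_lt
        (ENNReal.mul_lt_top ENNReal.ofReal_lt_top hV.lt_top)⟩)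
    (fun e he => by
      obtain ⟨e', he', he't, hee⟩ := exists_between he |>.imp fun e' h =>
        (⟨h.1, h.2.ne_top, h.2⟩ : 0 < e' ∧ e' ≠ ⊤ ∧ e' < e)
      obtain ⟨l, hl, hle⟩ := ENNReal.exists_pos_ofReal_rpow_le hV he' one_pos
      obtain ⟨N, hN⟩ := exists_norm_sub_lt hu hl
      refine ⟨N, fun j hj k hk => lt_of_le_of_lt ?_ hee⟩
      rw [hres]
      have h1 := hL1 (u j - u k) l hl (hN j hj k hk)
      simp only [hsub] at h1
      rw [ENNReal.rpow_one, mul_comm] at hle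
      exact h1.trans hle) hlim
  rw [hres] at htend
  obtain ⟨ns, hns, hae⟩ := exists_seq_tendsto_zero_of_eLpNorm (fun k => hsm (u k)) htend
  obtain ⟨N, hN⟩ := exists_norm_sub_lt hu hl
  filter_upwards [eventually_ge_atTop N] with k hk
  refine luxNorm_le_of_varModular hl (varModular_le_of_tendsto
    (F := fun i z => w z * ‖(fderiv ℝ (u k - u (ns (i + N)) : D.C1c) z).comp J‖ / l) D.ae1
    (aemeasurable_of_continuousOn contG)
    (fun i => (aemeasurable_of_continuousOn (hcontn _)).div_const l)
    (fun i => hmod _ l (hN k hk _ ?_)) ?_)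
  · exact le_trans (Nat.le_add_left N i) (hns.id_le _)
  · have hUae : ∀ᵐ z ∂D.μ, z ∈ U := by
      rw [← hres]; exact ae_restrict_mem hU.measurableSet
    filter_upwards [hae, hUae] with z hz hzU
    have h1 := (((tendsto_add_atTop_iff_nat N).2 hz).const_sub
      (w z • (fderiv ℝ (u k) z).comp J)).norm.div_const l
    simp only [← hsub, sub_zero] at h1
    simpa only [norm_smul, Real.norm_of_nonneg (hw0 z hzU).le] using h1

/-- The norm of `W` is closable with respect to convergence in `L¹`. -/
theorem tendsto_norm_zero (hn : 0 < n) (hu : CauchySeq u)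
    (hlim : Tendsto (fun k => eLpNorm (u k) 1 volume) atTop (𝓝 0)) :
    Tendsto (fun k => ‖u k‖) atTop (𝓝 0) := by
  have hG := aemeasurable_of_continuousOn (D := D) contG
  have hcw : ContinuousOn (fun z : GrushinPt n m => ‖z.1‖ ^ (D.γ / D.G z)) D.Ω := by
    refine ContinuousOn.rpow (by fun_prop)
      (continuousOn_const.div contG fun z hz => by linarith [D.two_lt_G z hz]) fun z hz =>
        Or.inr (div_pos D.γ_pos (by linarith [D.two_lt_G z hz]))
  have key : ∀ l : ℝ, 0 < l → ∀ᶠ k in atTop, ‖u k‖ ≤ 4 * l := by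
    intro l hl
    have h1 := eventually_luxNorm_fderiv_le hu hlim (ContinuousLinearMap.inl ℝ _ _)
      (w := fun _ => 1) continuousOn_const D.isOpen (ae_eq_refl _) subset_rfl
      (fun _ _ => one_pos) (fun u l hul => by
        simpa only [one_mul, norm_gradX (u.differentiable _)] using u.varModular_gradX_le hul) hl
    -- The weight vanishes on `{x = 0}`, so this null set is removed from `Ω`.
    have h2 := eventually_luxNorm_fderiv_le hu hlim (ContinuousLinearMap.inr ℝ _ _)
      (w := fun z => ‖z.1‖ ^ (D.γ / D.G z)) (U := D.Ω ∩ {z | z.1 ≠ 0}) hcw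
      (D.isOpen.inter (isOpen_ne_fun (by fun_prop) continuous_const))
      (by
        refine inter_ae_eq_left_of_ae_eq_univ (ae_eq_univ.2 ?_)
        convert GrushinPt.volume_fst_eq_zero (m := m) hn using 2
        ext z; simp)
      inter_subset_left
      (fun z hz => Real.rpow_pos_of_pos (norm_pos_iff.2 hz.2) _) (fun u l hul => by
        simpa only [norm_gradY (u.differentiable _)] using u.varModular_gradY_le hul) hl
    have h3 := eventually_luxNorm_mul_le hu hlim D.ae3 (hG.add_const 1)
      (fun u => aemeasurable_of_continuousOn u.cont3)
      (fun u l hul => u.varModular_add_one_le hul) hl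
    have h4 := eventually_luxNorm_mul_le hu hlim D.ae4 (hG.sub_const 1)
      (fun u => aemeasurable_of_continuousOn u.cont4)
      (fun u l hul => u.varModular_sub_one_le hul) hl
    filter_upwards [h1, h2, h3, h4] with k k1 k2 k3 k4
    simp only [one_mul, ← norm_gradX ((u k).differentiable _)] at k1
    simp only [← norm_gradY ((u k).differentiable _)] at k2
    rw [C1c.norm_eq, C1c.wNorm]
    linarith
  rw [Metric.tendsto_atTop']
  intro e he
  obtain ⟨N, hN⟩ := eventually_atTop.1 (key (e / 8) (by positivity))
  refine ⟨N, fun k hk => ?_⟩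
  have := hN k (le_of_lt hk)
  rw [Real.dist_0_eq_abs, abs_of_nonneg (norm_nonneg _)]
  linarith

end GrushinSetting

/-! ### The inclusion into `L^s`: boundedness, compactness, injectivity -/

theorem eLpNorm_le_of_lintegral_le {α F : Type*} [MeasurableSpace α] {ν : Measure α}
    [NormedAddCommGroup F] {s : ℝ} (hs : 0 < s) {f : α → F} {C : ℝ≥0∞}
    (h : ∫⁻ z, ‖f z‖ₑ ^ s ∂ν ≤ C) : eLpNorm f (ENNReal.ofReal s) ν ≤ C ^ (1 / s) := by
  rw [eLpNorm_eq_lintegral_rpow_enorm_toReal (by simpa using hs) ENNReal.ofReal_ne_top,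
    ENNReal.toReal_ofReal hs.le]
  exact ENNReal.rpow_le_rpow h (by positivity)

/-- Scaling by `t > ‖x‖` and letting `t ↓ ‖x‖` also covers vectors of seminorm zero. -/
theorem LinearMap.norm_le_mul_of_unit_ball {V V' : Type*} [SeminormedAddCommGroup V]
    [NormedSpace ℝ V] [SeminormedAddCommGroup V'] [NormedSpace ℝ V'] (f : V →ₗ[ℝ] V') {C : ℝ}
    (h : ∀ x, ‖x‖ < 1 → ‖f x‖ ≤ C) (x : V) : ‖f x‖ ≤ C * ‖x‖ := by
  have key : ∀ t : ℝ, ‖x‖ < t → ‖f x‖ ≤ C * t := by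
    intro t ht
    have ht0 : 0 < t := (norm_nonneg x).trans_lt ht
    have h1 := h (t⁻¹ • x) (by
      rw [norm_smul, norm_inv, Real.norm_of_nonneg ht0.le, inv_mul_lt_one₀ ht0]
      exact ht)
    rw [map_smul, norm_smul, norm_inv, Real.norm_of_nonneg ht0.le, inv_mul_le_iff₀ ht0] at h1
    linarith
  have hlim : Tendsto (fun t : ℝ => C * t) (𝓝[>] ‖x‖) (𝓝 (C * ‖x‖)) :=
    ((continuous_const.mul continuous_id).tendsto _).mono_left nhdsWithin_le_nhds
  exact ge_of_tendsto hlim (eventually_nhdsWithin_of_forall key)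

/-- By density, the open unit ball of the completion lies in the closure of the image of the unit
ball of `V`. Continuity then sends it into a closed totally bounded set. -/
theorem isCompactOperator_of_totallyBounded {V V' : Type*} [SeminormedAddCommGroup V]
    [NormedSpace ℝ V] [NormedAddCommGroup V'] [NormedSpace ℝ V'] [CompleteSpace V']
    (f : UniformSpace.Completion V →L[ℝ] V')
    (h : TotallyBounded ((fun x : V => f x) '' Metric.ball 0 1)) : IsCompactOperator f := by
  refine ⟨closure ((fun x : V => f x) '' Metric.ball 0 1),
    isCompact_iff_totallyBounded_isComplete.2 ⟨h.closure, isClosed_closure.isComplete⟩, ?_⟩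
  refine mem_of_superset (Metric.ball_mem_nhds 0 one_pos) fun x hx => ?_
  have h1 := (UniformSpace.Completion.denseRange_coe (α := V)).open_subset_closure_inter
    (Metric.isOpen_ball (x := (0 : UniformSpace.Completion V)) (ε := 1)) hx
  refine closure_mono ?_ (image_closure_subset_closure_image f.continuous (mem_image_of_mem f h1))
  rintro _ ⟨_, ⟨hy, y, rfl⟩, rfl⟩
  refine mem_image_of_mem _ ?_
  simpa using hy

namespace GrushinSetting

variable {n m : ℕ} {D : GrushinSetting n m} {s : ℝ}

theorem C1c.memLp (u : D.C1c) (p : ℝ≥0∞) : MemLp u p D.μ :=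
  (u.contDiff.continuous.memLp_of_hasCompactSupport u.isCompact).restrict _

theorem C1c.eLpNorm_one_eq (u : D.C1c) : eLpNorm u 1 volume = eLpNorm u 1 D.μ := by
  rw [eLpNorm_one_eq_lintegral_enorm, eLpNorm_one_eq_lintegral_enorm]
  exact lintegral_eq_setLIntegral D.isOpen.measurableSet fun z hz => by simp [u.eq_zero hz]

/-- The inclusion of `C¹_c(Ω)` in `L^p(Ω)`. -/
noncomputable def toLpLinear (D : GrushinSetting n m) (p : ℝ≥0∞) [Fact (1 ≤ p)] : D.C1c →ₗ[ℝ] Lp ℝ p D.μ where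
  toFun u := (u.memLp p).toLp u
  map_add' u v := MemLp.toLp_add (u.memLp p) (v.memLp p)
  map_smul' c u := MemLp.toLp_const_smul c (u.memLp p)

theorem enorm_toLpLinear (p : ℝ≥0∞) [Fact (1 ≤ p)] (u : D.C1c) :
    ‖D.toLpLinear p u‖ₑ = eLpNorm u p D.μ :=
  Lp.enorm_toLp (u.memLp p)

theorem norm_toLpLinear (p : ℝ≥0∞) [Fact (1 ≤ p)] (u : D.C1c) :
    ‖D.toLpLinear p u‖ = (eLpNorm u p D.μ).toReal :=
  Lp.norm_toLp _ (u.memLp p)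

theorem totallyBounded_toLpLinear (hn : 0 < n) (hs : 1 < s) (hsG : s < D.Gminus)
    [Fact (1 ≤ ENNReal.ofReal s)] :
    TotallyBounded (D.toLpLinear (ENNReal.ofReal s) '' Metric.ball 0 1) := by
  have hs0 : 0 < s := by linarith
  obtain ⟨C, hC, hCu⟩ := exists_lintegral_rpow_le hn D hs.le hsG.le
  refine Metric.totallyBounded_of_finite_discretization fun ε hε => ?_
  have hex : ∀ x : ↥(D.toLpLinear (ENNReal.ofReal s) '' Metric.ball 0 1),
      ∃ u : D.C1c, ‖u‖ < 1 ∧ D.toLpLinear (ENNReal.ofReal s) u = x := by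
    rintro ⟨_, u, hu, rfl⟩
    exact ⟨u, by simpa using hu, rfl⟩
  choose U hU hUx using hex
  -- Halving `ε` turns the non-strict integral bound into the strict distance bound required.
  have he : (0 : ℝ≥0∞) < ENNReal.ofReal (ε / 2) ^ s :=
    ENNReal.rpow_pos (by simpa using hε) ENNReal.ofReal_ne_top
  obtain ⟨β, hβ, F, hF⟩ := exists_finite_discretization (μ := volume) (s := s)
    (fun x => (U x : GrushinPt n m → ℝ)) hs.le (fun x => (U x).contDiff.continuous)
    (fun x => (U x).isCompact) hC (fun x => hCu _ (hU x))
    (fun e he => by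
      obtain ⟨δ, hδ, h⟩ := exists_translate_sub_le hn D hs hsG he
      exact ⟨δ, hδ, fun x => h (U x) (hU x)⟩) D.isBounded D.isOpen.measurableSet he
  have := Fintype.ofFinite β
  refine ⟨β, inferInstance, F, fun x y hxy => ?_⟩
  have h1 : ∫⁻ z, ‖(U x - U y : D.C1c) z‖ₑ ^ s ∂D.μ ≤ ENNReal.ofReal (ε / 2) ^ s := hF x y hxy
  rw [← hUx x, ← hUx y, dist_eq_norm, ← map_sub]
  refine lt_of_le_of_lt ?_ (half_lt_self hε)
  refine (norm_toLpLinear _ _).trans_le (ENNReal.toReal_le_of_le_ofReal (by positivity) ?_)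
  have h2 := eLpNorm_le_of_lintegral_le hs0 h1
  rwa [one_div, ENNReal.rpow_rpow_inv hs0.ne'] at h2

theorem exists_norm_toLpLinear_le (hn : 0 < n) (hs : 1 < s) (hsG : s < D.Gminus)
    [Fact (1 ≤ ENNReal.ofReal s)] :
    ∃ C : ℝ, ∀ u, ‖D.toLpLinear (ENNReal.ofReal s) u‖ ≤ C * ‖u‖ := by
  have hs0 : 0 < s := by linarith
  obtain ⟨C, hC, hCu⟩ := exists_lintegral_rpow_le hn D hs.le hsG.le
  refine ⟨(C ^ (1 / s)).toReal, LinearMap.norm_le_mul_of_unit_ball _ fun u hu => ?_⟩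
  refine (norm_toLpLinear _ _).trans_le (ENNReal.toReal_mono
    (ENNReal.rpow_ne_top_of_nonneg (by positivity) hC) ?_)
  exact eLpNorm_le_of_lintegral_le hs0 ((setLIntegral_le_lintegral _ _).trans (hCu u hu))

/-- On the finite-measure set `Ω`, convergence in `L^p` implies convergence in `L¹`, where
closability is available. -/
theorem tendsto_norm_zero_of_toLpLinear (hn : 0 < n) {p : ℝ≥0∞} [Fact (1 ≤ p)]
    {u : ℕ → D.C1c} (hu : CauchySeq u)
    (hlim : Tendsto (fun k => D.toLpLinear p (u k)) atTop (𝓝 0)) :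
    Tendsto (fun k => ‖u k‖) atTop (𝓝 0) := by
  refine tendsto_norm_zero hn hu ?_
  simp only [C1c.eLpNorm_one_eq]
  have h1 : Tendsto (fun k => eLpNorm (u k) p D.μ) atTop (𝓝 0) := by
    have h2 := (continuous_enorm.tendsto _).comp hlim
    rw [enorm_zero] at h2
    refine h2.congr fun k => ?_
    exact enorm_toLpLinear p (u k)
  have hp : (1 : ℝ≥0∞) ≤ p := Fact.out
  have hexp : 0 ≤ 1 / (1 : ℝ≥0∞).toReal - 1 / p.toReal := by
    rcases eq_or_ne p ⊤ with rfl | hpt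
    · simp
    · have : 1 ≤ p.toReal := by simpa using ENNReal.toReal_mono hpt hp
      have := (div_le_one (by linarith)).2 this
      simpa using this
  have h3 := ENNReal.Tendsto.mul_const (b := D.μ univ ^ (1 / (1 : ℝ≥0∞).toReal - 1 / p.toReal)) h1
    (Or.inr (ENNReal.rpow_ne_top_of_nonneg hexp (by simpa using D.volume_ne_top)))
  rw [zero_mul] at h3
  exact tendsto_of_tendsto_of_tendsto_of_le_of_le tendsto_const_nhds h3 (fun _ => zero_le)
    fun k => eLpNorm_le_eLpNorm_mul_rpow_measure_univ hp ((u k).memLp p).aestronglyMeasurable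

end GrushinSetting

theorem mainTheorem2 {n m : ℕ} (hn : 0 < n) (D : GrushinSetting n m) (s : ℝ)
    (hs : 1 < s) (hsG : s < D.Gminus) (hγ : D.γ < ((n : ℝ) + m) * (D.Gminus - s) / s) :
    haveI : Fact (1 ≤ ENNReal.ofReal s) := ⟨ENNReal.one_le_ofReal.2 hs.le⟩
    ∃ ι : D.W →L[ℝ] Lp ℝ (ENNReal.ofReal s) (volume.restrict D.Ω),
      (∀ u : D.C1c, ι (u : D.W) =ᵐ[volume.restrict D.Ω] u) ∧
      Function.Injective ι ∧ IsCompactOperator ι := by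
  have : Fact (1 ≤ ENNReal.ofReal s) := ⟨ENNReal.one_le_ofReal.2 hs.le⟩
  obtain ⟨C, hC⟩ := GrushinSetting.exists_norm_toLpLinear_le hn hs hsG
  set T := (D.toLpLinear (ENNReal.ofReal s)).mkContinuous C hC with hT
  set ι : D.W →L[ℝ] Lp ℝ (ENNReal.ofReal s) D.μ :=
    T.extend (UniformSpace.Completion.toComplL (𝕜 := ℝ) (E := D.C1c)) with hι
  have hcoe : ∀ u : D.C1c, ι (u : D.W) = D.toLpLinear (ENNReal.ofReal s) u := fun u =>
    T.extend_eq UniformSpace.Completion.denseRange_coe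
      (UniformSpace.Completion.isUniformInducing_coe D.C1c) u
  refine ⟨ι, fun u => ?_, ?_, ?_⟩
  · rw [hcoe]
    exact MemLp.coeFn_toLp (u.memLp _)
  · rw [injective_iff_map_eq_zero]
    intro x hx
    -- A kernel element is the limit of a Cauchy sequence in `C1c` whose `L^s` images tend to zero;
    -- closability forces its norm to vanish.
    obtain ⟨y, hy, hyx⟩ := mem_closure_iff_seq_limit.1
      (UniformSpace.Completion.denseRange_coe (α := D.C1c) x)
    choose u hu using hy
    obtain rfl : (fun k => (u k : D.W)) = y := funext hu
    have hcau : CauchySeq u :=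
      (UniformSpace.Completion.isUniformInducing_coe D.C1c).cauchy_map_iff.1 (by
        rw [map_map]; exact hyx.cauchySeq)
    have h1 : Tendsto (fun k => D.toLpLinear (ENNReal.ofReal s) (u k)) atTop (𝓝 0) := by
      have := (ι.continuous.tendsto x).comp hyx
      rw [hx] at this
      exact this.congr fun k => hcoe (u k)
    have h2 := GrushinSetting.tendsto_norm_zero_of_toLpLinear hn hcau h1
    have h3 : Tendsto (fun k => ‖u k‖) atTop (𝓝 ‖x‖) := by
      simpa only [UniformSpace.Completion.norm_coe] using hyx.norm
    exact norm_eq_zero.1 (tendsto_nhds_unique h3 h2)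
  · refine isCompactOperator_of_totallyBounded ι ?_
    simp only [hcoe]
    exact GrushinSetting.totallyBounded_toLpLinear hn hs hsG
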